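/- **Definitions.** Let $\mathcal H$ be a class of functions $\mathcal X\to\mathbb R$. *Covering number.* $\mathcal N(\mathcal H,m,\varepsilon)$ is the least integer $N$ such that for every $A\subset\mathcal X$ with $|A|\le m$ there is a set $\tilde{\mathcal H}$ of at most $N$ functions $\mathcal X\to\mathbb R$ such that every $h\in\mathcal H$ has some $\tilde h\in\tilde{\mathcal H}$ with $\frac1{|A|}\sum_{x\in A}|h(x)-\tilde h(x)|^2\le\varepsilon^2$. *Approximate description length.* Let $P$ be a distribution on a set $A$, $\mathcal G$ a class of functions $A\to\mathbb R$, and $n\ge 0$ real. A $(1,n)$-compressor for $(\mathcal G,P)$ consists of a probability space $(\Omega,\mu)$, an encoder $E:\Omega\times\mathcal G\to\{0,1\}^*$ and a decoder $\mathrm{Dec}:\{0,1\}^*\to\mathbb R^{A}$ such that for every $g\in\mathcal G$ the random function $\hat g=\mathrm{Dec}(E(\omega,g))$ satisfies $\mathbb E_\omega\,\hat g(x)=g(x)$ for every $x\in A$, $\mathbb E_{x\sim P}\mathbb E_\omega(\hat g(x)-g(x))^2\le 1$, and $\mathbb E_\omega\,\mathrm{len}(E(\omega,g))\le n$. The class $\mathcal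 H$ has approximate description length $n=n(m)$, where $n:\mathbb N\to[0,\infty)$, if for every $m$, every $A\subset\mathcal X$ with $|A|\le m$ and every distribution $P$ on $A$ there is a $(1,n(m))$-compressor for $(\mathcal H|_A,P)$. *Representativeness.* For a loss $\ell:\mathbb R\times\mathcal Y\to\mathbb R$, a probability measure $\mathcal D$ on $\mathcal X\times\mathcal Y$ and a sample $S=((x_i,y_i))_{i\le m}$, put $\ell_{\mathcal D}(h)=\mathbb E_{(x,y)\sim\mathcal D}\,\ell(h(x),y)$, $\ell_S(h)=\frac1m\sum_{i}\ell(h(x_i),y_i)$ and $\mathrm{rep}_{\mathcal D}(S,\mathcal H)=\sup_{h\in\mathcal H}\big(\ell_{\mathcal D}(h)-\ell_S(h)\big)$. **Theorem.** There is a universal constant $C>0$ such that the following holds for every class $\mathcal H$ of functions $\mathcal X\to\mathbb R$ with approximate description length $n=n(m)$. 1. For all $m\ge 0$ and $\varepsilon>0$, $\mathcal N(\mathcal H,m,\varepsilon)$ is finite and $$\log\mathcal N(\mathcal H,m,\varepsilon)\le C\,n(m)\,\lceil\varepsilon^{-2}\rceil .$$ 2. Let $\mathcal X,\mathcal Y$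 be measurable spaces and let $\ell:\mathbb R\times\mathcal Y\to\mathbb R$ be such that for every $y\in\mathcal Y$ the function $\ell(\cdot,y)$ is $L$-Lipschitz and bounded by $B$ in absolute value. Let $\mathcal D$ be a probability measure on $\mathcal X\times\mathcal Y$, and assume the usual measurability of the loss class: up to null sets, each $(x,y)\mapsto\ell(h(x),y)$ with $h\in\mathcal H$ is measurable, and for all $k\in\mathbb N$, $c\in\mathbb R$ and $a\in\mathbb R^k$ the map $((x_i,y_i))_{i\le k}\mapsto\sup_{h\in\mathcal H}\big(c\,\ell_{\mathcal D}(h)+\sum_{i}a_i\,\ell(h(x_i),y_i)\big)$ is measurable with respect to $\mathcal D^k$. Then for every $m\ge2$ the function $S\mapsto\mathrm{rep}_{\mathcal D}(S,\mathcal H)$ is integrable and $$\mathbb E_{S\sim\mathcal D^m}\,\mathrm{rep}_{\mathcal D}(S,\mathcal H)\le C\,\frac{(L+B)\sqrt{n(m)}}{\sqrt m}\,\log m .$$ Furthermore, for every $m\ge1$ and $\delta\in(0,1)$, with probability at least $1-\delta$ over $S\sim\mathcal D^m$, $$\mathrm{rep}_{\mathcal D}(S,\mathcal H)\le C\left(\frac{(L+B)\sqrt{n(m)}}{\sqrt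 m}\,\log m+B\sqrt{\frac{2\ln(2/\delta)}{m}}\right).$$ -/

import Mathlib

open MeasureTheory
open scoped NNReal ENNReal

universe u v w

noncomputable section

namespace ADL

/-! ### Covering numbers -/

/-- The finite family `T` of functions is an `ε`-cover of the class `H` in the `L²` distance of the
uniform distribution on the finite set `A`. -/
def IsCover {X : Type u} {V : Type v} [NormedAddCommGroup V]
    (H : Set (X → V)) (A : Finset X) (ε : ℝ) (T : Finset (X → V)) : Prop :=
  ∀ h ∈ H, ∃ g ∈ T, (∑ x ∈ A, ‖h x - g x‖ ^ 2) / (A.card : ℝ) ≤ ε ^ 2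

/-- The covering number `N(H, m, ε)`: the least integer `N` such that for every set `A` of at most
`m` points the class `H` has an `ε`-cover on `A` with at most `N` elements (`⊤` if there is no such
integer). -/
def coveringNumber {X : Type u} {V : Type v} [NormedAddCommGroup V]
    (H : Set (X → V)) (m : ℕ) (ε : ℝ) : ℕ∞ :=
  ⨅ (N : ℕ) (_ : ∀ A : Finset X, A.card ≤ m →
      ∃ T : Finset (X → V), T.card ≤ N ∧ IsCover H A ε T), (N : ℕ∞)

/-! ### Approximate description length -/

/-- The random function `F : Ω → X → V` is a `σ`-estimator for `f : X → V` under the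
distribution `D` on `X`: it is unbiased at every point, and in each unit direction the mean squared
error, in expectation over `x ∼ D`, is at most `σ²`. -/
structure IsEstimator {Ω : Type w} [MeasurableSpace Ω] (μ : Measure Ω) {X : Type u} {V : Type v}
    [NormedAddCommGroup V] [InnerProductSpace ℝ V]
    (σ : ℝ) (D : PMF X) (f : X → V) (F : Ω → X → V) : Prop where
  integrable : ∀ x, Integrable (fun ω => F ω x) μ
  unbiased : ∀ x, ∫ ω, F ω x ∂μ = f x
  secondMoment : ∀ u : V, ‖u‖ = 1 →
    ∑' x, D x * ∫⁻ ω, ENNReal.ofReal ((inner ℝ u (F ω x - f x)) ^ 2) ∂μ ≤ ENNReal.ofReal (σ ^ 2)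

/-- A `(σ, n)`-compressor for `(H, D)`: a probability space `(Ω, μ)`, a random encoder of the members
of `H` into bit strings, and a deterministic decoder, such that decoding the code of `h` is a
`σ`-estimator for `h` and the expected length of the code of `h` is at most `n`. -/
structure Compressor {X : Type u} {V : Type v} [NormedAddCommGroup V] [InnerProductSpace ℝ V]
    (σ : ℝ) (n : ℝ≥0) (H : Set (X → V)) (D : PMF X) where
  Ω : Type w
  [measurableSpace : MeasurableSpace Ω]
  μ : Measure Ω
  [isProbabilityMeasure : IsProbabilityMeasure μ]
  enc : Ω → H → List Bool
  dec : List Bool → X → V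
  measurable_enc : ∀ (h : H) (s : List Bool), MeasurableSet {ω | enc ω h = s}
  isEstimator : ∀ h : H, IsEstimator μ σ D (h : X → V) (fun ω => dec (enc ω h))
  length_le : ∀ h : H, ∫⁻ ω, ((enc ω h).length : ℝ≥0∞) ∂μ ≤ (n : ℝ≥0∞)

/-- The restriction `H|_A` of a class of functions to a finite set. -/
def restrictClass {X : Type u} {V : Type v} (H : Set (X → V)) (A : Finset X) : Set (A → V) :=
  (fun (h : X → V) (a : A) => h a) '' H

/-- The class `H` has approximate description length `n = n(m)`: for every `m`, every set `A` of at
most `m` points and every distribution `D` on `A`, there is a `(1, n(m))`-compressor for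
`(H|_A, D)`. -/
def HasADL {X : Type u} {V : Type v} [NormedAddCommGroup V] [InnerProductSpace ℝ V]
    (H : Set (X → V)) (n : ℕ → ℝ≥0) : Prop :=
  ∀ (m : ℕ) (A : Finset X), A.card ≤ m → ∀ D : PMF A,
    Nonempty (Compressor.{u, v, w} 1 (n m) (restrictClass H A) D)

/-! ### Losses and representativeness -/

/-- The distributional loss `ℓ_D(h) = E_{(x,y) ∼ D} ℓ(h(x), y)`. -/
def distLoss {X : Type u} {Y : Type v} [MeasurableSpace X] [MeasurableSpace Y]
    (ℓ : ℝ → Y → ℝ) (D : Measure (X × Y)) (h : X → ℝ) : ℝ :=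
  ∫ z, ℓ (h z.1) z.2 ∂D

/-- The empirical loss `ℓ_S(h) = (1/m) ∑ i, ℓ(h(x_i), y_i)`. -/
def empLoss {X : Type u} {Y : Type v} (ℓ : ℝ → Y → ℝ) {m : ℕ} (S : Fin m → X × Y)
    (h : X → ℝ) : ℝ :=
  (∑ i, ℓ (h (S i).1) (S i).2) / (m : ℝ)

/-- The representativeness `rep_D(S, H) = sup_{h ∈ H} (ℓ_D(h) - ℓ_S(h))`. -/
def rep {X : Type u} {Y : Type v} [MeasurableSpace X] [MeasurableSpace Y]
    (ℓ : ℝ → Y → ℝ) (D : Measure (X × Y)) (H : Set (X → ℝ)) {m : ℕ} (S : Fin m → X × Y) : ℝ :=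
  ⨆ h : H, (distLoss ℓ D (h : X → ℝ) - empLoss ℓ S (h : X → ℝ))

/-- The usual measurability convention of empirical process theory for the loss class of `H`: each
loss function `(x, y) ↦ ℓ(h(x), y)` is measurable, and so are, as functions of a sample, the suprema
over `H` of linear combinations of the losses on the sample points and of the distributional loss
(all up to null sets). It holds for instance when `H` is countable, and also when `H` contains a
countable subset whose pointwise sequential limits exhaust `H`, for bounded continuous losses. -/
structure MeasurableLossClass {X : Type u} {Y : Type v} [MeasurableSpace X] [MeasurableSpace Y]
    (ℓ : ℝ → Y → ℝ) (D : Measure (X × Y)) (H : Set (X → ℝ)) : Prop where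
  loss : ∀ h ∈ H, AEMeasurable (fun z : X × Y => ℓ (h z.1) z.2) D
  sup : ∀ (k : ℕ) (c : ℝ) (a : Fin k → ℝ),
    AEMeasurable
      (fun S : Fin k → X × Y =>
        ⨆ h : H, (c * distLoss ℓ D (h : X → ℝ) + ∑ i, a i * ℓ ((h : X → ℝ) (S i).1) (S i).2))
      (Measure.pi fun _ : Fin k => D)

end ADL

end

/-!
A `(1, n)`-compressor is turned into a cover by averaging: the mean of `4 k` independent decodings
of `h` has mean square error at most `1 / (4 k)`, and the codes have expected total length at most
`4 n k`, so some realization has squared error at most `1 / k` and total length at most `8 n k`.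
The mean depends only on the list of the *nonempty* words among the codes, and there are at most
`5 ^ M` lists of nonempty words of total length at most `M`. This gives `log N = O(n k)` with no
lower bound on `n`; in particular the cover is a single function as soon as `8 n k < 1`
(`exists_cover_of_compressor`). Covering numbers are the case of the uniform distribution on a set;
the empirical distribution of a sample, with repetitions, is treated in `HasADL.exists_cover`.

For the expected representativeness, symmetrization (`integral_ciSup_sub_le`) reduces the claim to
a bound on Rademacher averages that is uniform over samples, and this bound comes from chaining
(`signMean_chaining`) with Massart's lemma at the scales `ε = 1 / √(q 4 ^ j)`. As
`log N(ε) = O(n / ε²)`, each scale contributes `O(L √(n m))`. The coarsest scale has `q = 1` when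
`n` is bounded below, and `q` of order `1 / n` when `n` is small, where the cover is a single
function (`exists_initial_scale`). In either case `O(log m)` scales lead down to an error of
order `L √(n / m)` (`HasADL.signMean_loss_le`).

The bound in probability follows from the bounded difference inequality
(`ofReal_one_sub_le_of_boundedDifferences`), since changing one sample point changes the
representativeness by at most `2 B / m`.
-/

namespace ADL

/-! ### Covers from compressors -/

/-- Prepend the letter `b` to the first word of a list of words. -/
def prependHead (b : Bool) : List (List Bool) → List (List Bool)
  | [] => []
  | s :: t => (b :: s) :: t

/-- A finite set of at most `5 ^ M` lists of words that contains every list of nonempty words of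
total length at most `M` (`mem_wordLists`): a nonempty such list arises from a list of total length
`M - 1` by a new word of one letter or by one more letter in the first word. -/
def wordLists : ℕ → Finset (List (List Bool))
  | 0 => {[]}
  | M + 1 => insert [] (Finset.univ.biUnion fun b : Bool =>
      (wordLists M).image (fun l => [b] :: l) ∪ (wordLists M).image (prependHead b))

lemma card_wordLists_le (M : ℕ) : (wordLists M).card ≤ 5 ^ M := by
  induction M with
  | zero => simp [wordLists]
  | succ M ih =>
    have h1 : 1 ≤ 5 ^ M := Nat.one_le_pow _ _ (by norm_num)
    have hb : ∀ b ∈ (Finset.univ : Finset Bool), ((wordLists M).image (fun l => [b] :: l) ∪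
        (wordLists M).image (prependHead b)).card ≤ 2 * 5 ^ M := fun b _ => by
      have := Finset.card_union_le ((wordLists M).image (fun l => [b] :: l))
        ((wordLists M).image (prependHead b))
      have h2 := Finset.card_image_le (s := wordLists M) (f := fun l => [b] :: l)
      have h3 := Finset.card_image_le (s := wordLists M) (f := prependHead b)
      omega
    have h4 := Finset.card_biUnion_le_card_mul _ _ _ hb
    have h5 := Finset.card_insert_le [] (Finset.univ.biUnion fun b : Bool =>
      (wordLists M).image (fun l => [b] :: l) ∪ (wordLists M).image (prependHead b))
    rw [wordLists, pow_succ]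
    simp only [Finset.card_univ, Fintype.card_bool] at h4
    omega

lemma mem_wordLists (M : ℕ) : ∀ l : List (List Bool), [] ∉ l → (l.map List.length).sum ≤ M →
    l ∈ wordLists M := by
  induction M with
  | zero =>
    intro l hl hs
    rcases l with _ | ⟨_ | ⟨b, s⟩, t⟩
    · simp [wordLists]
    · simp at hl
    · simp at hs
  | succ M ih =>
    intro l hl hs
    rw [wordLists]
    rcases l with _ | ⟨_ | ⟨b, _ | ⟨c, s⟩⟩, t⟩
    · simp
    · simp at hl
    · refine Finset.mem_insert_of_mem (Finset.mem_biUnion.2 ⟨b, Finset.mem_univ _,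
        Finset.mem_union_left _ (Finset.mem_image.2 ⟨t, ih t ?_ ?_, rfl⟩)⟩)
      · simp_all
      · simp at hs; omega
    · refine Finset.mem_insert_of_mem (Finset.mem_biUnion.2 ⟨b, Finset.mem_univ _,
        Finset.mem_union_right _ (Finset.mem_image.2 ⟨(c :: s) :: t, ih _ ?_ ?_, rfl⟩)⟩)
      · simp_all
      · simp at hs ⊢; omega

/-- A sum over the words of a list depends only on the nonempty words and on the number of words. -/
lemma sum_map_eq_filter_ne_nil (d : List Bool → ℝ) (l : List (List Bool)) :
    (l.map d).sum = ((l.filter (· ≠ [])).map d).sum +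
      ((l.length : ℝ) - ((l.filter (· ≠ [])).length : ℝ)) * d [] := by
  induction l with
  | nil => simp
  | cons s l ih =>
    rcases s with _ | ⟨b, s⟩
    · simp only [List.map_cons, List.sum_cons, ih]
      simp
      ring
    · simp only [List.map_cons, List.sum_cons, ih]
      simp
      ring

lemma sum_length_filter_le (l : List (List Bool)) :
    ((l.filter (· ≠ [])).map List.length).sum ≤ (l.map List.length).sum :=
  ((List.filter_sublist (l := l)).map _).sum_le_sum (by simp)

/-- The averages of the decodings of `K` words of total length at most `M` form a set of at most
`5 ^ M` functions. The bound does not involve `K`, because an average depends only on the list of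
the nonempty words. -/
lemma exists_finset_averages {A : Type u} (dec : List Bool → A → ℝ) (K M : ℕ) :
    ∃ T : Finset (A → ℝ), T.card ≤ 5 ^ M ∧ ∀ s : Fin K → List Bool, ∑ i, (s i).length ≤ M →
      (fun a => (∑ i, dec (s i) a) / (K : ℝ)) ∈ T := by
  classical
  refine ⟨(wordLists M).image fun l a =>
    ((l.map fun w => dec w a).sum + ((K : ℝ) - (l.length : ℝ)) * dec [] a) / K,
    Finset.card_image_le.trans (card_wordLists_le M), fun s hs => ?_⟩
  refine Finset.mem_image.2 ⟨(List.ofFn s).filter (· ≠ []), mem_wordLists M _ (by simp) ?_, ?_⟩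
  · refine (sum_length_filter_le _).trans ?_
    rwa [List.map_ofFn, List.sum_ofFn]
  · funext a
    have := sum_map_eq_filter_ne_nil (fun w => dec w a) (List.ofFn s)
    rw [List.map_ofFn, List.sum_ofFn, List.length_ofFn] at this
    rw [← this]
    rfl

/-- The variance of the mean of `K` independent copies of `X` is at most `Var X / K`. -/
lemma lintegral_average_sub_sq_le {Ω : Type w} [MeasurableSpace Ω] (μ : Measure Ω)
    [IsProbabilityMeasure μ] (X : Ω → ℝ) (hX : Integrable X μ) {K : ℕ} (hK : 1 ≤ K) :
    ∫⁻ ω : Fin K → Ω, ENNReal.ofReal (((∑ i, X (ω i)) / (K : ℝ) - ∫ ω, X ω ∂μ) ^ 2)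
      ∂(Measure.pi fun _ => μ) ≤
    (∫⁻ ω, ENNReal.ofReal ((X ω - ∫ ω, X ω ∂μ) ^ 2) ∂μ) / (K : ℝ≥0∞) := by
  have hK0 : (K : ℝ) ≠ 0 := by positivity
  rw [← ProbabilityTheory.evariance_eq_lintegral_ofReal]
  by_cases hfin : MemLp X 2 μ
  swap
  · rw [ProbabilityTheory.evariance_eq_top hX.aestronglyMeasurable hfin,
      ENNReal.top_div_of_ne_top (by simp)]
    exact le_top
  set S : (Fin K → Ω) → ℝ := ∑ i, fun ω => X (ω i) with hS
  have hXi : ∀ i : Fin K, MemLp (fun ω : Fin K → Ω => X (ω i)) 2 (Measure.pi fun _ => μ) :=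
    fun i => hfin.comp_measurePreserving (measurePreserving_eval _ i)
  have hSm : MemLp S 2 (Measure.pi fun _ => μ) := memLp_finsetSum' _ fun i _ => hXi i
  have hV : ProbabilityTheory.variance S (Measure.pi fun _ => μ)
      = K * ProbabilityTheory.variance X μ := by
    rw [hS, ProbabilityTheory.variance_sum_pi (X := fun _ => X) (fun _ => hfin)]
    simp
  have hE : ∫ ω, (K : ℝ)⁻¹ * S ω ∂(Measure.pi fun _ => μ) = ∫ ω, X ω ∂μ := by
    rw [integral_const_mul, hS]
    simp only [Finset.sum_apply]
    rw [integral_finsetSum _ fun i _ => (hXi i).integrable (by norm_num)]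
    have : ∀ i : Fin K, ∫ ω : Fin K → Ω, X (ω i) ∂(Measure.pi fun _ => μ) = ∫ ω, X ω ∂μ :=
      fun i => integral_comp_eval (μ := fun _ : Fin K => μ) hX.aestronglyMeasurable
    simp only [this, Finset.sum_const, Finset.card_univ, Fintype.card_fin, nsmul_eq_mul]
    field_simp
  have key : ∫⁻ ω : Fin K → Ω, ENNReal.ofReal (((∑ i, X (ω i)) / (K : ℝ) - ∫ ω, X ω ∂μ) ^ 2)
      ∂(Measure.pi fun _ => μ) = ProbabilityTheory.evariance (fun ω => (K : ℝ)⁻¹ * S ω)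
        (Measure.pi fun _ => μ) := by
    rw [ProbabilityTheory.evariance_eq_lintegral_ofReal, hE]
    refine lintegral_congr fun ω => ?_
    rw [hS, Finset.sum_apply, div_eq_inv_mul]
  rw [key, ← (hSm.const_mul _).ofReal_variance_eq, ← hfin.ofReal_variance_eq,
    ProbabilityTheory.variance_const_mul, hV, ← ENNReal.ofReal_natCast,
    ← ENNReal.ofReal_div_of_pos (by positivity)]
  refine ENNReal.ofReal_le_ofReal (le_of_eq ?_)
  field_simp

/-- Among the realizations of `4 k` independent codes of `h`, one has both a small average error
and a small total length, by the first moment method. -/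
lemma exists_codes {A : Type u} [Fintype A] {n : ℝ≥0} {G : Set (A → ℝ)} {D : PMF A}
    (c : Compressor.{u, 0, w} 1 n G D) (h : G) {r : ℝ} (hn : (n : ℝ) ≤ r) (hr : 0 < r) {k : ℕ}
    (hk : 1 ≤ k) :
    ∃ s : Fin (4 * k) → List Bool, (∑ i, ((s i).length : ℝ)) ≤ 8 * r * k ∧
      ∑ a, (D a).toReal * ((h : A → ℝ) a - (∑ i, c.dec (s i) a) / ((4 * k : ℕ) : ℝ)) ^ 2
        ≤ 1 / (k : ℝ) := by
  obtain ⟨Ω, μ, enc, dec, hme, hest, hlen⟩ := c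
  have hk0 : (0 : ℝ) < k := by exact_mod_cast hk
  let : MeasurableSpace (List Bool) := ⊤
  have henc : Measurable (enc · h) := measurable_to_countable' fun s => hme h s
  have hest := hest h
  have hX : ∀ a, Integrable (fun ω => dec (enc ω h) a) μ := hest.integrable
  set f : A → ℝ := (h : A → ℝ) with hf
  set K := 4 * k with hKdef
  have hF : ∀ a : A, Measurable fun ω => dec (enc ω h) a := fun a =>
    (measurable_from_top (f := fun s => dec s a)).comp henc
  have hl : Measurable fun ω => ((enc ω h).length : ℝ≥0∞) :=
    (measurable_from_top (f := fun s : List Bool => (s.length : ℝ≥0∞))).comp henc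
  set P : Measure (Fin K → Ω) := Measure.pi fun _ => μ
  set U : (Fin K → Ω) → ℝ≥0∞ := fun ω => (k : ℝ≥0∞) * ∑ a, D a *
    ENNReal.ofReal (((∑ i, dec (enc (ω i) h) a) / (K : ℝ) - f a) ^ 2) with hU
  set W : (Fin K → Ω) → ℝ≥0∞ := fun ω => (ENNReal.ofReal (8 * r * k))⁻¹ *
    ∑ i, ((enc (ω i) h).length : ℝ≥0∞) with hW
  have hFi : ∀ a : A, ∀ i : Fin K, Measurable fun ω : Fin K → Ω => dec (enc (ω i) h) a :=
    fun a i => (hF a).comp (measurable_pi_apply i)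
  have hli : ∀ i : Fin K, Measurable fun ω : Fin K → Ω => ((enc (ω i) h).length : ℝ≥0∞) :=
    fun i => hl.comp (measurable_pi_apply i)
  have hUa : ∀ a : A, Measurable fun ω : Fin K → Ω =>
      ENNReal.ofReal (((∑ i, dec (enc (ω i) h) a) / (K : ℝ) - f a) ^ 2) := fun a =>
    (((Finset.measurable_sum _ fun i _ => hFi a i).div_const _).sub_const _
      |>.pow_const 2).ennreal_ofReal
  have hUm : Measurable U := Measurable.const_mul
    (Finset.measurable_sum _ fun a _ => (hUa a).const_mul _) _
  have hWm : Measurable W := Measurable.const_mul (Finset.measurable_sum _ fun i _ => hli i) _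
  have hUint : ∫⁻ ω, U ω ∂P ≤ 1 / 4 := by
    have h2 := hest.secondMoment 1 (by simp)
    rw [tsum_fintype] at h2
    simp only [RCLike.inner_apply, conj_trivial, mul_one, one_pow, ENNReal.ofReal_one] at h2
    rw [hU, lintegral_const_mul _ (Finset.measurable_sum _ fun a _ => (hUa a).const_mul _),
      lintegral_finsetSum _ fun a _ => (hUa a).const_mul _]
    calc (k : ℝ≥0∞) * ∑ a, ∫⁻ ω, D a * ENNReal.ofReal
            (((∑ i, dec (enc (ω i) h) a) / (K : ℝ) - f a) ^ 2) ∂P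
        ≤ (k : ℝ≥0∞) * ∑ a, D a * ((∫⁻ ω, ENNReal.ofReal ((dec (enc ω h) a - f a) ^ 2) ∂μ)
            / (K : ℝ≥0∞)) := by
          gcongr with a
          rw [lintegral_const_mul _ (hUa a)]
          gcongr
          have := lintegral_average_sub_sq_le μ _ (hX a) (K := K) (by omega)
          rwa [hest.unbiased a] at this
      _ = (k : ℝ≥0∞) / (K : ℝ≥0∞) *
            ∑ a, D a * ∫⁻ ω, ENNReal.ofReal ((dec (enc ω h) a - f a) ^ 2) ∂μ := by
          simp only [div_eq_mul_inv, Finset.mul_sum]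
          refine Finset.sum_congr rfl fun a _ => ?_
          ring
      _ ≤ (k : ℝ≥0∞) / (K : ℝ≥0∞) * 1 := by
          gcongr
      _ = 1 / 4 := by
          rw [mul_one, hKdef, Nat.cast_mul]
          have hk' : (k : ℝ≥0∞) ≠ 0 := by exact_mod_cast (by omega : k ≠ 0)
          have := ENNReal.mul_div_mul_right (1 : ℝ≥0∞) ((4 : ℕ) : ℝ≥0∞) hk' (by simp)
          rw [one_mul] at this
          rw [this]
          norm_num
  have hWint : ∫⁻ ω, W ω ∂P ≤ 1 / 2 := by
    rw [hW, lintegral_const_mul _ (Finset.measurable_sum _ fun i _ => hli i),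
      lintegral_finsetSum _ fun i _ => hli i]
    have h1 : ∀ i : Fin K, ∫⁻ ω : Fin K → Ω, ((enc (ω i) h).length : ℝ≥0∞) ∂P ≤ n := fun i => by
      refine le_trans (le_of_eq ?_) (hlen h)
      exact (measurePreserving_eval (fun _ : Fin K => μ) i).lintegral_comp hl
    calc _ ≤ (ENNReal.ofReal (8 * r * k))⁻¹ * ∑ i : Fin K, (n : ℝ≥0∞) := by
          gcongr with i
          exact h1 i
      _ ≤ (ENNReal.ofReal (8 * r * k))⁻¹ * ENNReal.ofReal (4 * r * k) := by
          gcongr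
          rw [Finset.sum_const, Finset.card_univ, Fintype.card_fin, nsmul_eq_mul,
            ← ENNReal.ofReal_coe_nnreal, ← ENNReal.ofReal_natCast,
            ← ENNReal.ofReal_mul (by positivity)]
          refine ENNReal.ofReal_le_ofReal ?_
          rw [hKdef]
          push_cast
          nlinarith
      _ = 1 / 2 := by
          rw [mul_comm, ← div_eq_mul_inv, ← ENNReal.ofReal_div_of_pos (by positivity),
            show (4 * r * k) / (8 * r * k) = (1 / 2 : ℝ) by field_simp; norm_num]
          rw [ENNReal.ofReal_div_of_pos (by norm_num)]
          simp
  obtain ⟨ω, hω⟩ := exists_le_lintegral (μ := P) (f := fun ω => U ω + W ω)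
    (hUm.add hWm).aemeasurable
  rw [lintegral_add_left hUm] at hω
  have hle : U ω + W ω ≤ 1 := hω.trans <| (add_le_add hUint hWint).trans <| by
    rw [← ENNReal.toReal_le_toReal (by simp) (by simp), ENNReal.toReal_add (by simp) (by simp)]
    norm_num
  have hU1 : U ω ≤ 1 := le_self_add.trans hle
  have hW1 : W ω ≤ 1 := le_add_self.trans hle
  refine ⟨fun i => enc (ω i) h, ?_, ?_⟩
  · rw [hW] at hW1
    dsimp only at hW1
    rw [mul_comm, ← div_eq_mul_inv, ENNReal.div_le_iff (by simp; positivity) (by simp), one_mul,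
      ENNReal.le_ofReal_iff_toReal_le (by simp) (by positivity),
      ENNReal.toReal_sum (by simp)] at hW1
    simpa using hW1
  · have hk' : (k : ℝ≥0∞) ≠ 0 := by exact_mod_cast (by omega : k ≠ 0)
    rw [hU] at hU1
    dsimp only at hU1
    rw [mul_comm, ← ENNReal.le_div_iff_mul_le (by simp [hk']) (by simp)] at hU1
    have h3 := ENNReal.toReal_mono (by simp [hk']) hU1
    rw [ENNReal.toReal_sum fun a _ => ENNReal.mul_ne_top (D.apply_ne_top a) (by simp)] at h3
    refine le_trans (le_of_eq (Finset.sum_congr rfl fun a _ => ?_)) (h3.trans (by simp))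
    rw [ENNReal.toReal_mul, ENNReal.toReal_ofReal (by positivity)]
    ring

/-- A class with a `(1, n)`-compressor has an `L²(D)` cover of squared radius `1 / k` of cardinality
exponential in `n k`, also when `n k` is small: for `8 r k < 1` the cover is a single function. -/
lemma exists_cover_of_compressor {A : Type u} [Fintype A] {n : ℝ≥0} {G : Set (A → ℝ)} {D : PMF A}
    (c : Compressor.{u, 0, w} 1 n G D) {r : ℝ} (hn : (n : ℝ) ≤ r) (hr : 0 < r) {k : ℕ}
    (hk : 1 ≤ k) :
    ∃ T : Finset (A → ℝ), T.card ≤ 5 ^ ⌊8 * r * k⌋₊ ∧ ∀ h ∈ G, ∃ g ∈ T,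
      ∑ a, (D a).toReal * (h a - g a) ^ 2 ≤ 1 / (k : ℝ) := by
  obtain ⟨T, hT, hTs⟩ := exists_finset_averages c.dec (4 * k) ⌊8 * r * k⌋₊
  refine ⟨T, hT, fun h hh => ?_⟩
  obtain ⟨s, hs, he⟩ := exists_codes c ⟨h, hh⟩ hn hr hk
  exact ⟨_, hTs s (Nat.le_floor (by exact_mod_cast hs)), he⟩

/-- The cover of `exists_cover_of_compressor` for the empirical distribution of a sample, in which
points may repeat. -/
lemma HasADL.exists_cover {X : Type u} {H : Set (X → ℝ)} {n : ℕ → ℝ≥0}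
    (hH : HasADL.{u, 0, w} H n) {ι : Type*} [Fintype ι] [Nonempty ι] {m : ℕ}
    (hm : Fintype.card ι ≤ m) (x : ι → X) {r : ℝ} (hn : (n m : ℝ) ≤ r) (hr : 0 < r) {k : ℕ}
    (hk : 1 ≤ k) :
    ∃ T : Finset (X → ℝ), T.card ≤ 5 ^ ⌊8 * r * k⌋₊ ∧ ∀ h ∈ H, ∃ g ∈ T,
      (∑ i, (h (x i) - g (x i)) ^ 2) / (Fintype.card ι : ℝ) ≤ 1 / (k : ℝ) := by
  classical
  set A : Finset X := Finset.univ.image x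
  have hx : ∀ i, x i ∈ A := fun i => Finset.mem_image_of_mem _ (Finset.mem_univ i)
  set y : ι → A := fun i => ⟨x i, hx i⟩ with hy
  set D : PMF A := (PMF.uniformOfFintype ι).map y with hD
  obtain ⟨c⟩ := hH m A (Finset.card_image_le.trans hm) D
  have hsum : ∀ φ : A → ℝ, ∑ a, (D a).toReal * φ a
      = (∑ i, φ (y i)) / (Fintype.card ι : ℝ) := fun φ => by
    have hDa : ∀ a, (D a).toReal = ∑ i, if a = y i then (Fintype.card ι : ℝ)⁻¹ else 0 :=
      fun a => by
        rw [hD, PMF.map_apply, tsum_fintype, ENNReal.toReal_sum (by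
          intro i _; split_ifs <;> simp)]
        refine Finset.sum_congr rfl fun i _ => ?_
        split_ifs <;> simp
    simp only [hDa, Finset.sum_mul]
    rw [Finset.sum_comm, Finset.sum_div]
    refine Finset.sum_congr rfl fun i _ => ?_
    simp only [ite_mul, zero_mul, Finset.sum_ite_eq', Finset.mem_univ, if_true]
    ring
  obtain ⟨T, hT, hTc⟩ := exists_cover_of_compressor c hn hr hk
  refine ⟨T.image fun g z => if hz : z ∈ A then g ⟨z, hz⟩ else 0, Finset.card_image_le.trans hT,
    fun h hh => ?_⟩
  obtain ⟨g, hg, hgd⟩ := hTc (fun a => h a) ⟨h, hh, rfl⟩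
  refine ⟨_, Finset.mem_image_of_mem _ hg, ?_⟩
  rw [hsum (fun a => (h a - g a) ^ 2)] at hgd
  simpa [hx, hy] using hgd

lemma log_pow_floor_le {c : ℝ} (hc : 0 ≤ c) {N : ℕ} (hN : N ≤ 5 ^ ⌊c⌋₊) :
    Real.log N ≤ 2 * c := by
  rcases Nat.eq_zero_or_pos N with rfl | h0
  · simpa using hc
  have h5 : Real.log 5 ≤ 2 := by
    rw [Real.log_le_iff_le_exp (by norm_num)]
    have := Real.exp_one_gt_d9
    calc (5 : ℝ) ≤ Real.exp 1 * Real.exp 1 := by nlinarith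
      _ = Real.exp 2 := by rw [← Real.exp_add]; norm_num
  calc Real.log N ≤ Real.log ((5 : ℝ) ^ ⌊c⌋₊) :=
        Real.log_le_log (by exact_mod_cast h0) (by exact_mod_cast hN)
    _ = ⌊c⌋₊ * Real.log 5 := by rw [Real.log_pow]
    _ ≤ c * 2 := by
        have := Nat.floor_le hc
        have := Real.log_nonneg (by norm_num : (1 : ℝ) ≤ 5)
        gcongr
    _ = 2 * c := mul_comm _ _

theorem HasADL.log_coveringNumber_le {X : Type u} {H : Set (X → ℝ)} {n : ℕ → ℝ≥0}
    (hH : HasADL.{u, 0, w} H n) (m : ℕ) {ε : ℝ} (hε : 0 < ε) :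
    coveringNumber H m ε ≠ ⊤ ∧
      Real.log ((coveringNumber H m ε).toNat : ℝ) ≤ 16 * ((n m : ℝ) * (⌈1 / ε ^ 2⌉₊ : ℝ)) := by
  set k := ⌈1 / ε ^ 2⌉₊ with hkdef
  have hk : 1 ≤ k := Nat.one_le_ceil_iff.2 (by positivity)
  have hkε : 1 / (k : ℝ) ≤ ε ^ 2 := by
    have := Nat.le_ceil (1 / ε ^ 2)
    rw [← hkdef, div_le_iff₀ (by positivity)] at this
    rw [div_le_iff₀ (by exact_mod_cast hk)]
    linarith
  have hcov : ∀ r : ℝ, (n m : ℝ) < r →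
      coveringNumber H m ε ≤ ((5 ^ ⌊8 * r * k⌋₊ : ℕ) : ℕ∞) := fun r hr => by
    refine iInf₂_le _ fun A hA => ?_
    have hr0 : 0 < r := lt_of_le_of_lt (n m).2 hr
    rcases A.eq_empty_or_nonempty with rfl | hne
    · refine ⟨{0}, by simpa using Nat.one_le_pow _ _ (by norm_num), fun h _ => ⟨0, by simp, ?_⟩⟩
      simp [sq_nonneg]
    · have : Nonempty A := hne.to_subtype
      obtain ⟨T, hT, hTc⟩ := hH.exists_cover (ι := A) (m := m) (by simpa using hA)
        (fun a => (a : X)) hr.le hr0 hk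
      refine ⟨T, hT, fun h hh => ?_⟩
      obtain ⟨g, hg, hgd⟩ := hTc h hh
      refine ⟨g, hg, le_trans (le_of_eq ?_) (hgd.trans hkε)⟩
      rw [Fintype.card_coe, ← Finset.sum_coe_sort A]
      simp
  have htop : coveringNumber H m ε ≠ ⊤ :=
    ((hcov (n m + 1) (by linarith)).trans_lt (ENat.natCast_lt_top _)).ne
  refine ⟨htop, ?_⟩
  -- The cover was built for description lengths `r > n m`, and the bound is continuous in `r`.
  have hlim : Filter.Tendsto (fun r : ℝ => 16 * (r * (k : ℝ))) (nhdsWithin (n m : ℝ) (Set.Ioi (n m)))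
      (nhds (16 * ((n m : ℝ) * (k : ℝ)))) :=
    (Continuous.tendsto (by fun_prop) _).mono_left nhdsWithin_le_nhds
  refine ge_of_tendsto hlim (Filter.eventually_of_mem self_mem_nhdsWithin fun r hr => ?_)
  have hr0 : 0 < r := lt_of_le_of_lt (n m).2 hr
  have := log_pow_floor_le (c := 8 * r * k) (by positivity)
    (ENat.toNat_le_of_le_natCast (hcov r hr))
  linarith

/-! ### Rademacher averages and chaining -/

/-- The sign `±1` encoded by a bit. -/
def boolSign (b : Bool) : ℝ := if b then 1 else -1

/-- The mean of `∑ i, σ i * a σ i` over uniformly random signs `σ`, for a vector `a σ` that may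
depend on the signs. The Rademacher average of a set of vectors is the supremum of these means over
all choices of `a` with values in the set, which avoids suprema inside the mean. -/
noncomputable def signMean {ι : Type*} [Fintype ι] [DecidableEq ι] (a : (ι → Bool) → ι → ℝ) : ℝ :=
  (∑ σ : ι → Bool, ∑ i, boolSign (σ i) * a σ i) / 2 ^ Fintype.card ι

section SignMean

variable {ι : Type*} [Fintype ι] [DecidableEq ι]

lemma boolSign_sq (b : Bool) : boolSign b ^ 2 = 1 := by
  cases b <;> simp [boolSign]

lemma boolSign_not (b : Bool) : boolSign (!b) = -boolSign b := by
  cases b <;> simp [boolSign]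

lemma signMean_add (a b : (ι → Bool) → ι → ℝ) :
    signMean (fun σ i => a σ i + b σ i) = signMean a + signMean b := by
  simp only [signMean, mul_add, Finset.sum_add_distrib, add_div]

lemma signMean_le_of_forall_le {a : (ι → Bool) → ι → ℝ} {c : ℝ}
    (h : ∀ σ, ∑ i, boolSign (σ i) * a σ i ≤ c) : signMean a ≤ c := by
  rw [signMean, div_le_iff₀ (by positivity)]
  refine (Finset.sum_le_sum fun σ _ => h σ).trans (le_of_eq ?_)
  simp [mul_comm]

/-- Flipping all signs does not change the distribution of the signs. -/
lemma signMean_not (a : (ι → Bool) → ι → ℝ) :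
    signMean (fun σ i => -a (fun j => !σ j) i) = signMean a := by
  have e : Function.Involutive (fun (σ : ι → Bool) j => !σ j) := fun σ => by simp
  rw [signMean, signMean]
  congr 1
  refine Fintype.sum_equiv e.toPerm _ _ fun σ => ?_
  simp [Function.Involutive.toPerm, boolSign_not]

lemma le_sqrt_of_forall_pos_le {x a b : ℝ} (ha : 0 ≤ a) (hb : 0 ≤ b)
    (h : ∀ t : ℝ, 0 < t → t * x ≤ a + b * t ^ 2) :
    x ≤ √(4 * a * b) := by
  by_cases hx : x ≤ 0
  · exact hx.trans (Real.sqrt_nonneg _)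
  refine Real.le_sqrt_of_sq_le ?_
  have := discrim_le_zero (a := b) (b := -x) (c := a) fun t => by
    rcases le_or_gt t 0 with ht | ht
    · nlinarith [mul_nonneg hb (mul_self_nonneg t), mul_nonneg (neg_nonneg.2 ht) (not_le.1 hx).le]
    · nlinarith [h t ht]
  rw [discrim] at this
  nlinarith

lemma sum_exp_sign_le (v : ι → ℝ) (t : ℝ) :
    ∑ σ : ι → Bool, Real.exp (t * ∑ i, boolSign (σ i) * v i)
      ≤ 2 ^ Fintype.card ι * Real.exp ((∑ i, v i ^ 2) * t ^ 2 / 2) := by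
  have h1 : ∀ σ : ι → Bool, Real.exp (t * ∑ i, boolSign (σ i) * v i)
      = ∏ i, Real.exp (t * (boolSign (σ i) * v i)) := fun σ => by
    rw [← Real.exp_sum, Finset.mul_sum]
  have h2 := Finset.prod_univ_sum (fun _ : ι => (Finset.univ : Finset Bool))
    (fun i b => Real.exp (t * (boolSign b * v i)))
  rw [Fintype.piFinset_univ] at h2
  rw [Finset.sum_congr rfl fun σ _ => h1 σ, ← h2]
  calc ∏ i, ∑ b : Bool, Real.exp (t * (boolSign b * v i))
      ≤ ∏ i, (2 * Real.exp ((t * v i) ^ 2 / 2)) := by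
        refine Finset.prod_le_prod (fun i _ => by positivity) fun i _ => ?_
        have := Real.cosh_le_exp_half_sq (t * v i)
        rw [Real.cosh_eq] at this
        simp only [Fintype.sum_bool, boolSign, if_true, Bool.false_eq_true, if_false, one_mul,
          neg_mul, mul_neg]
        linarith
    _ = _ := by
        rw [Finset.prod_mul_distrib, Finset.prod_const, Finset.card_univ, ← Real.exp_sum,
          Finset.sum_mul, Finset.sum_div]
        simp only [mul_pow]
        congr 2
        exact Finset.sum_congr rfl fun i _ => by ring

/-- Massart's finite class lemma. -/
lemma signMean_le_of_mem_finset (F : Finset (ι → ℝ)) {R κ : ℝ} (hR : ∀ v ∈ F, ∑ i, v i ^ 2 ≤ R)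
    (hκ : Real.log F.card ≤ κ) (a : (ι → Bool) → ι → ℝ) (ha : ∀ σ, a σ ∈ F) :
    signMean a ≤ √(2 * κ * R) := by
  have hcard : 0 < F.card := Finset.card_pos.2 ⟨_, ha fun _ => true⟩
  have hR0 : 0 ≤ R := (Finset.sum_nonneg fun i _ => sq_nonneg _).trans (hR _ (ha fun _ => true))
  have hκ0 : 0 ≤ κ := (Real.log_nonneg (by exact_mod_cast hcard)).trans hκ
  have key : ∀ t : ℝ, 0 < t → t * signMean a ≤ κ + R / 2 * t ^ 2 := fun t _ => by
    set c := κ + R / 2 * t ^ 2 with hc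
    have h1 : ∑ σ : ι → Bool, Real.exp (t * ∑ i, boolSign (σ i) * a σ i)
        ≤ 2 ^ Fintype.card ι * Real.exp c := by
      calc _ ≤ ∑ σ : ι → Bool, ∑ v ∈ F, Real.exp (t * ∑ i, boolSign (σ i) * v i) :=
            Finset.sum_le_sum fun σ _ => Finset.single_le_sum
              (f := fun v : ι → ℝ => Real.exp (t * ∑ i, boolSign (σ i) * v i))
              (fun v _ => (Real.exp_pos _).le) (ha σ)
        _ = ∑ v ∈ F, ∑ σ : ι → Bool, Real.exp (t * ∑ i, boolSign (σ i) * v i) :=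
            Finset.sum_comm
        _ ≤ ∑ v ∈ F, 2 ^ Fintype.card ι * Real.exp (R / 2 * t ^ 2) := by
            refine Finset.sum_le_sum fun v hv => (sum_exp_sign_le v t).trans ?_
            have := mul_le_mul_of_nonneg_right (hR v hv) (sq_nonneg t)
            gcongr
            linarith
        _ = F.card * (2 ^ Fintype.card ι * Real.exp (R / 2 * t ^ 2)) := by
            rw [Finset.sum_const, nsmul_eq_mul]
        _ ≤ Real.exp κ * (2 ^ Fintype.card ι * Real.exp (R / 2 * t ^ 2)) := by
            gcongr
            rwa [← Real.log_le_iff_le_exp (by exact_mod_cast hcard)]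
        _ = _ := by rw [hc, Real.exp_add]; ring
    -- `1 + (x - c) ≤ exp (x - c)` replaces Jensen's inequality.
    have h2 : ∑ σ : ι → Bool, (1 + (t * (∑ i, boolSign (σ i) * a σ i) - c))
        ≤ 2 ^ Fintype.card ι := by
      calc _ ≤ ∑ σ : ι → Bool, Real.exp (t * (∑ i, boolSign (σ i) * a σ i)) * Real.exp (-c) :=
            Finset.sum_le_sum fun σ _ => by
              rw [← Real.exp_add, ← sub_eq_add_neg, add_comm]
              exact Real.add_one_le_exp _
        _ ≤ 2 ^ Fintype.card ι * Real.exp c * Real.exp (-c) := by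
            rw [← Finset.sum_mul]
            gcongr
        _ = _ := by rw [mul_assoc, ← Real.exp_add]; simp
    have h3 : ∑ σ : ι → Bool, (1 + (t * (∑ i, boolSign (σ i) * a σ i) - c))
        = 2 ^ Fintype.card ι * (1 - c) + t * ∑ σ : ι → Bool, ∑ i, boolSign (σ i) * a σ i := by
      rw [Finset.sum_congr rfl fun σ _ => (by ring : 1 + (t * (∑ i, boolSign (σ i) * a σ i) - c)
        = (1 - c) + t * ∑ i, boolSign (σ i) * a σ i), Finset.sum_add_distrib, ← Finset.mul_sum]
      simp
      ring
    rw [h3] at h2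
    have hp : (0 : ℝ) < 2 ^ Fintype.card ι := by positivity
    rw [signMean, ← mul_div_assoc, div_le_iff₀ hp]
    linarith
  have := le_sqrt_of_forall_pos_le hκ0 (by positivity) key
  rwa [show 4 * κ * (R / 2) = 2 * κ * R by ring] at this

lemma signMean_le_sqrt {a : (ι → Bool) → ι → ℝ} {R : ℝ} (ha : ∀ σ, ∑ i, a σ i ^ 2 ≤ R) :
    signMean a ≤ √(Fintype.card ι * R) := by
  refine signMean_le_of_forall_le fun σ => Real.le_sqrt_of_sq_le ?_
  have := Finset.sum_mul_sq_le_sq_mul_sq Finset.univ (fun i => boolSign (σ i)) (a σ)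
  simp only [boolSign_sq, Finset.sum_const, Finset.card_univ, nsmul_eq_mul, mul_one] at this
  exact this.trans (by gcongr; exact ha σ)

/-- Chaining through finite approximations `p j h ∈ F j` of the vectors `v h`. -/
lemma signMean_chaining {I : Type*} (v : I → ι → ℝ) (p : ℕ → I → ι → ℝ)
    (F : ℕ → Finset (ι → ℝ)) (hp : ∀ j h, p j h ∈ F j) {R κ : ℕ → ℝ} {R' κ' : ℝ}
    (hv : ∀ j h, ∑ i, (v h i - p j h i) ^ 2 ≤ R j) (hκ : ∀ j, Real.log (F j).card ≤ κ j)
    (hR' : ∀ w ∈ F 0, ∑ i, w i ^ 2 ≤ R') (hκ' : Real.log (F 0).card ≤ κ') (J : ℕ)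
    (a : (ι → Bool) → I) :
    signMean (fun σ => v (a σ)) ≤ √(2 * κ' * R') +
      ∑ j ∈ Finset.range J, √(2 * (κ j + κ (j + 1)) * (2 * (R j + R (j + 1)))) +
      √(Fintype.card ι * R J) := by
  have hstep : ∀ J : ℕ, signMean (fun σ => p J (a σ)) ≤ √(2 * κ' * R') +
      ∑ j ∈ Finset.range J, √(2 * (κ j + κ (j + 1)) * (2 * (R j + R (j + 1)))) := fun J => by
    induction J with
    | zero => simpa using signMean_le_of_mem_finset (F 0) hR' hκ' _ fun σ => hp 0 (a σ)
    | succ J ih =>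
      have h1 : signMean (fun σ => p (J + 1) (a σ)) = signMean (fun σ => p J (a σ)) +
          signMean (fun σ i => p (J + 1) (a σ) i - p J (a σ) i) := by
        rw [← signMean_add]
        simp
      classical
      set G : Finset (ι → ℝ) := ((F J ×ˢ F (J + 1)).image fun w i => w.2 i - w.1 i).filter
        fun w => ∑ i, w i ^ 2 ≤ 2 * (R J + R (J + 1)) with hG
      have hmem : ∀ h, (fun i => p (J + 1) h i - p J h i) ∈ G := fun h => by
        refine Finset.mem_filter.2 ⟨Finset.mem_image.2 ⟨(p J h, p (J + 1) h),
          Finset.mem_product.2 ⟨hp _ _, hp _ _⟩, rfl⟩, ?_⟩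
        calc ∑ i, (p (J + 1) h i - p J h i) ^ 2
            ≤ ∑ i, 2 * ((v h i - p J h i) ^ 2 + (v h i - p (J + 1) h i) ^ 2) :=
              Finset.sum_le_sum fun i _ => by
                nlinarith [sq_nonneg ((v h i - p J h i) + (v h i - p (J + 1) h i))]
          _ ≤ _ := by
              rw [← Finset.mul_sum, Finset.sum_add_distrib]
              linarith [hv J h, hv (J + 1) h]
      have hGcard : Real.log G.card ≤ κ J + κ (J + 1) := by
        have h0 : 0 < G.card := Finset.card_pos.2 ⟨_, hmem (a fun _ => true)⟩
        have h1 : G.card ≤ (F J).card * (F (J + 1)).card :=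
          (Finset.card_filter_le _ _).trans (Finset.card_image_le.trans
            (Finset.card_product _ _).le)
        have hJ : ∀ j, ((F j).card : ℝ) ≠ 0 := fun j => by
          exact_mod_cast (Finset.card_pos.2 ⟨_, hp j (a fun _ => true)⟩).ne'
        calc Real.log G.card ≤ Real.log ((F J).card * (F (J + 1)).card) :=
              Real.log_le_log (by exact_mod_cast h0) (by exact_mod_cast h1)
          _ = Real.log (F J).card + Real.log (F (J + 1)).card := Real.log_mul (hJ _) (hJ _)
          _ ≤ _ := add_le_add (hκ _) (hκ _)
      have h2 := signMean_le_of_mem_finset G (fun w hw => (Finset.mem_filter.1 hw).2) hGcard _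
        fun σ => hmem (a σ)
      rw [h1, Finset.sum_range_succ]
      linarith
  have h1 : signMean (fun σ => v (a σ)) = signMean (fun σ => p J (a σ)) +
      signMean (fun σ i => v (a σ) i - p J (a σ) i) := by
    rw [← signMean_add]
    simp
  rw [h1]
  exact add_le_add (hstep J) (signMean_le_sqrt fun σ => hv J (a σ))

end SignMean

/-- The coarsest scale of the chaining: `q = 1` unless `r` is small, and otherwise `q` of order
`1 / r` so small that the cover of squared radius `1 / q` is a single function. -/
lemma exists_initial_scale {r : ℝ} (hr : 0 < r) :
    ∃ q : ℕ, 1 ≤ q ∧ 1 ≤ 32 * r * q ∧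
      ∀ N : ℕ, N ≤ 5 ^ ⌊8 * r * q⌋₊ → Real.log N ≤ 16 * r := by
  rcases le_or_gt (1 / 16) r with h | h
  · refine ⟨1, le_rfl, by push_cast; linarith, fun N hN => ?_⟩
    have := log_pow_floor_le (by positivity) hN
    push_cast at this
    linarith
  · have h1 : 1 ≤ 1 / (16 * r) := by rw [le_div_iff₀ (by positivity)]; linarith
    have hq1 : 1 ≤ ⌊1 / (16 * r)⌋₊ := Nat.one_le_floor_iff _ |>.2 h1
    have hle : (⌊1 / (16 * r)⌋₊ : ℝ) * (16 * r) ≤ 1 := by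
      rw [← le_div_iff₀ (by positivity)]
      exact Nat.floor_le (by positivity)
    have hlt : 1 < ((⌊1 / (16 * r)⌋₊ : ℝ) + 1) * (16 * r) := by
      rw [← div_lt_iff₀ (by positivity)]
      exact Nat.lt_floor_add_one _
    have hq1' : (1 : ℝ) ≤ ⌊1 / (16 * r)⌋₊ := by exact_mod_cast hq1
    refine ⟨⌊1 / (16 * r)⌋₊, hq1, by nlinarith, fun N hN => ?_⟩
    rw [Nat.floor_eq_zero.2 (by linarith), pow_zero] at hN
    have : Real.log N ≤ 0 := Real.log_nonpos (by positivity) (by exact_mod_cast hN)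
    linarith

/-- The Rademacher bound for the loss class on any `m` points. The scales of the chaining are
`1 / √(q * 4 ^ j)` for `j ≤ J = O(log m)`; every scale contributes `O(L √(r m))`. -/
lemma HasADL.signMean_loss_le {X : Type u} {Y : Type v} {H : Set (X → ℝ)} {n : ℕ → ℝ≥0}
    (hH : HasADL.{u, 0, w} H n) {ℓ : ℝ → Y → ℝ} {L : ℝ≥0} {B : ℝ}
    (hL : ∀ y, LipschitzWith L (fun t => ℓ t y)) (hB : ∀ t y, |ℓ t y| ≤ B) {m : ℕ} (hm : 2 ≤ m)
    {r : ℝ} (hn : (n m : ℝ) ≤ r) (hr : 0 < r) (S : Fin m → X × Y) (a : (Fin m → Bool) → H) :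
    signMean (fun σ i => ℓ ((a σ : X → ℝ) (S i).1) (S i).2)
      ≤ 70 * ((L : ℝ) + B) * √(r * m) * Real.log m := by
  classical
  obtain ⟨q, hq, hrq, hlog⟩ := exists_initial_scale hr
  have : NeZero m := ⟨by omega⟩
  have hm0 : (0 : ℝ) < m := by positivity
  have hB0 : 0 ≤ B := (abs_nonneg _).trans (hB 0 (S 0).2)
  set k : ℕ → ℕ := fun j => q * 4 ^ j with hk
  have hk1 : ∀ j, 1 ≤ k j := fun j => Nat.mul_pos hq (by positivity)
  have hk0 : ∀ j, (0 : ℝ) < k j := fun j => by exact_mod_cast hk1 j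
  choose T hT hTc using fun j => hH.exists_cover (ι := Fin m) (m := m) (by simp)
    (fun i => (S i).1) hn hr (hk1 j)
  choose g hg hgd using fun j (h : H) => hTc j h h.2
  set F : ℕ → Finset (Fin m → ℝ) := fun j => (T j).image fun g i => ℓ (g (S i).1) (S i).2 with hF
  have hcard : ∀ j, (F j).card ≤ 5 ^ ⌊8 * r * k j⌋₊ := fun j => Finset.card_image_le.trans (hT j)
  have hv : ∀ j (h : H), ∑ i, (ℓ ((h : X → ℝ) (S i).1) (S i).2 - ℓ (g j h (S i).1) (S i).2) ^ 2
      ≤ m * (L : ℝ) ^ 2 / k j := fun j h => by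
    have h1 := hgd j h
    rw [Fintype.card_fin, div_le_iff₀ hm0] at h1
    calc ∑ i, (ℓ ((h : X → ℝ) (S i).1) (S i).2 - ℓ (g j h (S i).1) (S i).2) ^ 2
        ≤ ∑ i, (L : ℝ) ^ 2 * ((h : X → ℝ) (S i).1 - g j h (S i).1) ^ 2 := by
          refine Finset.sum_le_sum fun i _ => ?_
          rw [← mul_pow, sq_le_sq, abs_mul, NNReal.abs_eq]
          simpa [Real.dist_eq] using
            (hL (S i).2).dist_le_mul ((h : X → ℝ) (S i).1) (g j h (S i).1)
      _ ≤ (L : ℝ) ^ 2 * (1 / k j * m) := by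
          rw [← Finset.mul_sum]
          gcongr
      _ = _ := by ring
  have hch := signMean_chaining (fun (h : H) i => ℓ ((h : X → ℝ) (S i).1) (S i).2)
    (fun j h i => ℓ (g j h (S i).1) (S i).2) F (fun j h => Finset.mem_image_of_mem _ (hg j h))
    (R := fun j => m * (L : ℝ) ^ 2 / k j) (κ := fun j => 16 * r * k j) (R' := m * B ^ 2)
    (κ' := 16 * r) hv
    (fun j => (log_pow_floor_le (by positivity) (hcard j)).trans_eq (by ring)) ?_
    (hlog _ (by simpa [hk] using hcard 0)) (Nat.log 2 m + 1) a
  swap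
  · intro w hw
    obtain ⟨g, -, rfl⟩ := Finset.mem_image.1 hw
    calc ∑ i, ℓ (g (S i).1) (S i).2 ^ 2 ≤ ∑ i : Fin m, B ^ 2 :=
          Finset.sum_le_sum fun i _ => sq_le_sq' (abs_le.1 (hB _ _)).1 (abs_le.1 (hB _ _)).2
      _ = _ := by simp
  refine hch.trans ?_
  set s := √(r * m) with hs
  have hs0 : 0 ≤ s := Real.sqrt_nonneg _
  have hss : s ^ 2 = r * m := Real.sq_sqrt (by positivity)
  have e1 : √(2 * (16 * r) * (m * B ^ 2)) ≤ 6 * B * s := by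
    refine Real.sqrt_le_iff.2 ⟨by positivity, ?_⟩
    rw [mul_pow, hss]
    have : 0 ≤ r * m * B ^ 2 := by positivity
    nlinarith
  have e2 : ∀ j, √(2 * (16 * r * k j + 16 * r * k (j + 1)) *
      (2 * (m * (L : ℝ) ^ 2 / k j + m * (L : ℝ) ^ 2 / k (j + 1)))) = 20 * L * s := fun j => by
    have hkk : (k (j + 1) : ℝ) = 4 * k j := by
      simp only [hk]; push_cast; ring
    rw [hkk, Real.sqrt_eq_iff_mul_self_eq (by have := hk0 j; positivity) (by positivity)]
    have := (hk0 j).ne'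
    have : 20 * L * s * (20 * L * s) = 400 * L ^ 2 * (r * m) := by rw [← hss]; ring
    rw [this]
    field_simp
    ring
  have hkJ : (m : ℝ) ≤ 32 * r * k (Nat.log 2 m + 1) := by
    have h1 : m ≤ 4 ^ (Nat.log 2 m + 1) :=
      (Nat.lt_pow_succ_log_self (by norm_num) m).le.trans (Nat.pow_le_pow_left (by norm_num) _)
    have h2 : (m : ℝ) ≤ 4 ^ (Nat.log 2 m + 1) := by exact_mod_cast h1
    simp only [hk]
    push_cast
    calc (m : ℝ) ≤ 1 * 4 ^ (Nat.log 2 m + 1) := by linarith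
      _ ≤ (32 * r * q) * 4 ^ (Nat.log 2 m + 1) := by gcongr
      _ = _ := by ring
  have e3 : √(Fintype.card (Fin m) * (m * (L : ℝ) ^ 2 / k (Nat.log 2 m + 1))) ≤ 6 * L * s := by
    refine Real.sqrt_le_iff.2 ⟨by positivity, ?_⟩
    have hkJ0 := hk0 (Nat.log 2 m + 1)
    rw [mul_pow, hss, Fintype.card_fin, ← mul_div_assoc, div_le_iff₀ hkJ0]
    have h0 : 0 ≤ m * (L : ℝ) ^ 2 := by positivity
    have h1 : 0 ≤ m * (L : ℝ) ^ 2 * (r * k (Nat.log 2 m + 1)) := by positivity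
    nlinarith [mul_le_mul_of_nonneg_left hkJ h0]
  have hlog2 := Real.log_two_gt_d9
  have hlm : Real.log 2 ≤ Real.log m := Real.log_le_log (by norm_num) (by exact_mod_cast hm)
  have hJ : ((Nat.log 2 m + 1 : ℕ) : ℝ) ≤ 3 * Real.log m := by
    have h1 : (Nat.log 2 m : ℝ) * Real.log 2 ≤ Real.log m := by
      rw [← Real.log_pow]
      exact Real.log_le_log (by positivity) (by exact_mod_cast Nat.pow_log_le_self 2 (by omega))
    have h2 : (1 : ℝ) ≤ Nat.log 2 m := by
      exact_mod_cast Nat.log_pos (by norm_num) hm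
    push_cast
    nlinarith
  simp only [e2, Finset.sum_const, Finset.card_range, nsmul_eq_mul]
  have hLs : 0 ≤ (L : ℝ) * s := by positivity
  have hBs : 0 ≤ B * s := by positivity
  have h4 := mul_le_mul_of_nonneg_right hJ hLs
  have h5 := mul_le_mul_of_nonneg_left hlm hLs
  have h6 := mul_le_mul_of_nonneg_left hlm hBs
  nlinarith

/-! ### Symmetrization -/

section Symmetrization

variable {Z I : Type*} {f : I → Z → ℝ} {B : ℝ}

lemma abs_sum_sub_le (hB : ∀ h z, |f h z| ≤ B) {m : ℕ} (S S' : Fin m → Z) (h : I) :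
    |∑ i, (f h (S' i) - f h (S i))| ≤ m * (2 * B) := by
  refine (Finset.abs_sum_le_sum_abs _ _).trans
    ((Finset.sum_le_sum fun i _ => ?_).trans (b := ∑ _i : Fin m, 2 * B) (by simp))
  have := abs_sub (f h (S' i)) (f h (S i))
  linarith [hB h (S' i), hB h (S i)]

lemma abs_ciSup_le [Nonempty I] {φ : I → ℝ} {K : ℝ} (h : ∀ i, |φ i| ≤ K) : |⨆ i, φ i| ≤ K :=
  abs_le.2 ⟨(abs_le.1 (h (Classical.arbitrary I))).1.trans
    (le_ciSup ⟨K, by rintro _ ⟨i, rfl⟩; exact (abs_le.1 (h i)).2⟩ _),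
    ciSup_le fun i => (abs_le.1 (h i)).2⟩

lemma bddAbove_range_of_abs_le {φ : I → ℝ} {K : ℝ} (h : ∀ i, |φ i| ≤ K) :
    BddAbove (Set.range φ) :=
  ⟨K, by rintro _ ⟨i, rfl⟩; exact (abs_le.1 (h i)).2⟩

/-- The sum over all signs of the suprema of the symmetrized process on a sample of pairs. -/
lemma sum_sign_ciSup_le [Nonempty I] {m : ℕ} {c : ℝ}
    (hc : ∀ (S : Fin m → Z) (a : (Fin m → Bool) → I), signMean (fun σ i => f (a σ) (S i)) ≤ c)
    (S S' : Fin m → Z) :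
    ∑ σ : Fin m → Bool, ⨆ h, ∑ i, boolSign (σ i) * (f h (S' i) - f h (S i))
      ≤ 2 ^ m * (2 * c) := by
  refine le_of_forall_pos_le_add fun ε hε => ?_
  have hε' : 0 < ε / 2 ^ m := by positivity
  have hsel : ∀ σ : Fin m → Bool, ∃ h, (⨆ h, ∑ i, boolSign (σ i) * (f h (S' i) - f h (S i)))
      - ε / 2 ^ m < ∑ i, boolSign (σ i) * (f h (S' i) - f h (S i)) := fun σ =>
    exists_lt_of_lt_ciSup (by linarith)
  choose a ha using hsel
  have h1 := hc S' a
  have h2 := hc S fun σ => a fun j => !σ j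
  rw [← signMean_not (fun σ i => f (a fun j => !σ j) (S i))] at h2
  simp only [Bool.not_not] at h2
  have h3 := add_le_add h1 h2
  rw [← signMean_add, signMean, div_le_iff₀ (by positivity), Fintype.card_fin] at h3
  calc _ ≤ ∑ σ : Fin m → Bool, ((∑ i, boolSign (σ i) * (f (a σ) (S' i) - f (a σ) (S i)))
        + ε / 2 ^ m) := Finset.sum_le_sum fun σ _ => by linarith [ha σ]
    _ = (∑ σ : Fin m → Bool, ∑ i, boolSign (σ i) * (f (a σ) (S' i) + -f (a σ) (S i))) + ε := by
        rw [Finset.sum_add_distrib]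
        simp only [sub_eq_add_neg, Finset.sum_const, Finset.card_univ, Fintype.card_pi,
          Fintype.card_bool, Finset.prod_const, Fintype.card_fin, nsmul_eq_mul]
        congr 1
        push_cast
        field_simp
    _ ≤ _ := by linarith

variable [MeasurableSpace Z] {D : Measure Z} [IsProbabilityMeasure D]

lemma measurePreserving_append (D : Measure Z) [SigmaFinite D] (m : ℕ) :
    MeasurePreserving (fun p : (Fin m → Z) × (Fin m → Z) => Fin.append p.1 p.2)
      ((Measure.pi fun _ => D).prod (Measure.pi fun _ => D))
      (Measure.pi fun _ : Fin (m + m) => D) := by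
  have h := (measurePreserving_piCongrLeft (fun _ : Fin (m + m) => D) finSumFinEquiv).comp
    (measurePreserving_sumPiEquivProdPi_symm (fun _ : Fin m ⊕ Fin m => D))
  convert h using 1
  funext p i
  obtain ⟨x, rfl⟩ := finSumFinEquiv.surjective i
  rw [Function.comp_apply, MeasurableEquiv.piCongrLeft_apply_apply]
  rcases x with x | x
  · rw [finSumFinEquiv_apply_left, Fin.append_left]
    rfl
  · rw [finSumFinEquiv_apply_right, Fin.append_right]
    rfl

/-- Exchanging the two points of the pairs at the indices `i` with `σ i = false`. -/
def swapPairs {m : ℕ} (σ : Fin m → Bool) (w : Fin m → Z × Z) : Fin m → Z × Z :=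
  fun i => (if σ i then id else Prod.swap) (w i)

lemma measurePreserving_swapPairs {m : ℕ} (σ : Fin m → Bool) :
    MeasurePreserving (swapPairs (Z := Z) σ) (Measure.pi fun _ => D.prod D)
      (Measure.pi fun _ => D.prod D) := by
  refine measurePreserving_pi (fun _ : Fin m => D.prod D) (fun _ => D.prod D)
    (f := fun i => if σ i then id else Prod.swap) fun i => ?_
  split_ifs
  · exact MeasurePreserving.id _
  · exact Measure.measurePreserving_swap

/-- Symmetrization: a uniform bound `c` for the Rademacher averages of the class `f` on samples of
size `m` gives the bound `2 c / m` for the expected representativeness. -/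
theorem integral_ciSup_sub_le [Nonempty I] (hf : ∀ h, AEMeasurable (f h) D)
    (hB : ∀ h z, |f h z| ≤ B)
    (hsup : ∀ (k : ℕ) (c : ℝ) (a : Fin k → ℝ), AEMeasurable
      (fun S : Fin k → Z => ⨆ h, (c * ∫ z, f h z ∂D + ∑ i, a i * f h (S i)))
      (Measure.pi fun _ => D))
    {m : ℕ} (hm : 1 ≤ m) {c : ℝ}
    (hc : ∀ (S : Fin m → Z) (a : (Fin m → Bool) → I), signMean (fun σ i => f (a σ) (S i)) ≤ c)
    (hint : Integrable (fun S : Fin m → Z => ⨆ h, (∫ z, f h z ∂D - (∑ i, f h (S i)) / m))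
      (Measure.pi fun _ => D)) :
    ∫ S : Fin m → Z, ⨆ h, (∫ z, f h z ∂D - (∑ i, f h (S i)) / m) ∂(Measure.pi fun _ => D)
      ≤ 2 * c / m := by
  have hm0 : (0 : ℝ) < m := by exact_mod_cast hm
  set μ : Measure (Fin m → Z) := Measure.pi fun _ => D with hμ
  set Q : Measure (Fin m → Z × Z) := Measure.pi fun _ => D.prod D with hQ
  set G : (Fin m → Z) × (Fin m → Z) → ℝ := fun p => ⨆ h, ∑ i, (f h (p.2 i) - f h (p.1 i)) with hG
  have hGb : ∀ p, |G p| ≤ m * (2 * B) := fun p => abs_ciSup_le fun h => abs_sum_sub_le hB _ _ h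
  have hGm : AEMeasurable G (μ.prod μ) := by
    have h1 := (hsup (m + m) 0 (Fin.append (fun _ => -1) fun _ => 1)).comp_quasiMeasurePreserving
      (measurePreserving_append D m).quasiMeasurePreserving
    refine h1.congr (Filter.Eventually.of_forall fun p => ?_)
    simp only [Function.comp_apply, Fin.sum_univ_add, Fin.append_left, Fin.append_right, hG]
    refine iSup_congr fun h => ?_
    simp only [neg_mul, one_mul, zero_mul, zero_add, Finset.sum_neg_distrib,
      Finset.sum_sub_distrib]
    ring
  have hGi : Integrable G (μ.prod μ) :=
    Integrable.of_bound hGm.aestronglyMeasurable _ (Filter.Eventually.of_forall hGb)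
  have hfi : ∀ h, ∀ i : Fin m, Integrable (fun S : Fin m → Z => f h (S i)) μ := fun h i =>
    Integrable.of_bound ((hf h).comp_quasiMeasurePreserving
      (measurePreserving_eval (fun _ => D) i).quasiMeasurePreserving).aestronglyMeasurable B
      (Filter.Eventually.of_forall fun S => hB h _)
  have hfint : ∀ h, ∀ i : Fin m, ∫ S : Fin m → Z, f h (S i) ∂μ = ∫ z, f h z ∂D := fun h i =>
    integral_comp_eval (μ := fun _ : Fin m => D) (hf h).aestronglyMeasurable
  have hdi : ∀ (S : Fin m → Z) h i, Integrable (fun S' : Fin m → Z => f h (S' i) - f h (S i)) μ :=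
    fun S h i => (hfi h i).sub (integrable_const _)
  -- A second, independent sample represents the distributional loss.
  have hghost : ∫ S : Fin m → Z, ⨆ h, (∫ z, f h z ∂D - (∑ i, f h (S i)) / m) ∂μ
      ≤ (∫ p, G p ∂(μ.prod μ)) / m := by
    rw [integral_prod _ hGi, ← integral_div]
    refine integral_mono_ae hint (hGi.integral_prod_left.div_const _) ?_
    filter_upwards [hGi.prod_right_ae] with S hS
    refine ciSup_le fun h => ?_
    have h1 : ∫ S' : Fin m → Z, ∑ i, (f h (S' i) - f h (S i)) ∂μ
        = m * ∫ z, f h z ∂D - ∑ i, f h (S i) := by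
      rw [integral_finsetSum _ fun i _ => hdi S h i]
      simp only [integral_sub (hfi h _) (integrable_const _), hfint]
      simp [Finset.sum_sub_distrib]
    have h2 : ∫ S' : Fin m → Z, ∑ i, (f h (S' i) - f h (S i)) ∂μ ≤ ∫ S', G (S, S') ∂μ :=
      integral_mono (integrable_finsetSum _ fun i _ => hdi S h i) hS
        fun S' => le_ciSup (f := fun h => ∑ i, (f h (S' i) - f h (S i)))
          (bddAbove_range_of_abs_le fun h => abs_sum_sub_le hB _ _ h) h
    rw [h1] at h2
    rw [le_div_iff₀ hm0, sub_mul, div_mul_cancel₀ _ hm0.ne']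
    linarith
  set e := MeasurableEquiv.arrowProdEquivProdArrow Z Z (Fin m) with he
  have hemp : MeasurePreserving e Q (μ.prod μ) :=
    measurePreserving_arrowProdEquivProdArrow Z Z (Fin m) (fun _ => D) (fun _ => D)
  have hGe : ∀ σ : Fin m → Bool, ∀ w, G (e (swapPairs σ w))
      = ⨆ h, ∑ i, boolSign (σ i) * (f h (w i).2 - f h (w i).1) := fun σ w => by
    refine iSup_congr fun h => Finset.sum_congr rfl fun i _ => ?_
    have e1 : (e (swapPairs σ w)).1 i = (swapPairs σ w i).1 := rfl
    have e2 : (e (swapPairs σ w)).2 i = (swapPairs σ w i).2 := rfl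
    rw [e1, e2, swapPairs, boolSign]
    split_ifs <;> simp
  have hσ : ∀ σ : Fin m → Bool, MeasurePreserving (fun w => e (swapPairs σ w)) Q (μ.prod μ) :=
    fun σ => hemp.comp (measurePreserving_swapPairs σ)
  have hσint : ∀ σ : Fin m → Bool, ∫ w, G (e (swapPairs σ w)) ∂Q = ∫ p, G p ∂(μ.prod μ) :=
    fun σ => by
      rw [← (hσ σ).map_eq, integral_map (hσ σ).aemeasurable]
      rw [(hσ σ).map_eq]
      exact hGi.aestronglyMeasurable
  have hsum : 2 ^ m * ∫ p, G p ∂(μ.prod μ) ≤ 2 ^ m * (2 * c) := by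
    calc 2 ^ m * ∫ p, G p ∂(μ.prod μ) = ∑ σ : Fin m → Bool, ∫ w, G (e (swapPairs σ w)) ∂Q := by
          simp [hσint]
      _ = ∫ w, ∑ σ : Fin m → Bool, G (e (swapPairs σ w)) ∂Q :=
          (integral_finsetSum _ fun σ _ => (hσ σ).integrable_comp_of_integrable hGi).symm
      _ ≤ ∫ _, 2 ^ m * (2 * c) ∂Q := by
          refine integral_mono (integrable_finsetSum _ fun σ _ =>
            (hσ σ).integrable_comp_of_integrable hGi) (integrable_const _) fun w => ?_
          simp only [hGe]
          exact sum_sign_ciSup_le hc (fun i => (w i).1) fun i => (w i).2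
      _ = _ := by simp
  have hG2 := le_of_mul_le_mul_left hsum (by positivity)
  exact hghost.trans (by gcongr)

end Symmetrization

/-! ### The bounded difference inequality -/

section BoundedDifferences

variable {Z : Type*} [MeasurableSpace Z] {D : Measure Z} [IsProbabilityMeasure D]

lemma integrable_exp_of_abs_le {Ω : Type*} [MeasurableSpace Ω] {μ : Measure Ω}
    [IsFiniteMeasure μ] {F : Ω → ℝ} (hF : AEMeasurable F μ) {K : ℝ} (hK : ∀ ω, |F ω| ≤ K)
    (t a : ℝ) : Integrable (fun ω => Real.exp (t * (F ω - a))) μ := by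
  refine Integrable.of_bound
    (Real.measurable_exp.comp_aemeasurable ((hF.sub_const a).const_mul t)).aestronglyMeasurable
    (Real.exp (|t| * (K + |a|))) (Filter.Eventually.of_forall fun ω => ?_)
  rw [Real.norm_eq_abs, Real.abs_exp]
  refine Real.exp_le_exp.2 ((le_abs_self _).trans ?_)
  rw [abs_mul]
  gcongr
  exact (abs_sub _ _).trans (by linarith [hK ω])

lemma integral_exp_sub_integral_le {φ : Z → ℝ} (hφ : AEMeasurable φ D) {a c : ℝ}
    (h : ∀ᵐ z ∂D, |φ z - a| ≤ c) (t : ℝ) :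
    ∫ z, Real.exp (t * (φ z - ∫ z, φ z ∂D)) ∂D ≤ Real.exp (c ^ 2 * t ^ 2 / 2) := by
  have h1 := ProbabilityTheory.hasSubgaussianMGF_of_mem_Icc hφ (a := a - c) (b := a + c)
    (h.mono fun z hz => ⟨by linarith [(abs_le.1 hz).1], by linarith [(abs_le.1 hz).2]⟩)
  refine (h1.mgf_le t).trans (le_of_eq ?_)
  congr 1
  push_cast
  rw [Real.norm_eq_abs, div_pow, sq_abs]
  ring

/-- The moment generating function bound of McDiarmid's inequality, by induction on the number of
variables: the mean over all variables but the first again has bounded differences. -/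
theorem integral_exp_le_of_boundedDifferences {m : ℕ} {F : (Fin m → Z) → ℝ}
    (hF : AEMeasurable F (Measure.pi fun _ => D)) {K c : ℝ} (hK : ∀ S, |F S| ≤ K)
    (hc : ∀ S i z, |F (Function.update S i z) - F S| ≤ c) (t : ℝ) :
    ∫ S, Real.exp (t * (F S - ∫ S, F S ∂(Measure.pi fun _ => D))) ∂(Measure.pi fun _ => D)
      ≤ Real.exp (m * c ^ 2 * t ^ 2 / 2) := by
  induction m with
  | zero =>
    have : ∀ S, F S = F default := fun S => by rw [Subsingleton.elim S default]
    simp [this]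
  | succ m ih =>
    set μ : Measure (Fin m → Z) := Measure.pi fun _ => D with hμ
    set e := (MeasurableEquiv.piFinSuccAbove (fun _ : Fin (m + 1) => Z) 0).symm with he
    have hemp : MeasurePreserving e (D.prod μ) (Measure.pi fun _ => D) :=
      (measurePreserving_piFinSuccAbove (fun _ : Fin (m + 1) => D) 0).symm
    have hecons : ∀ z S, e (z, S) = Fin.cons z S := fun z S => by
      simp only [he, MeasurableEquiv.piFinSuccAbove, Fin.insertNthEquiv_zero]
      rfl
    set F' : Z × (Fin m → Z) → ℝ := fun p => F (e p) with hF'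
    have hF'm : AEMeasurable F' (D.prod μ) :=
      hF.comp_quasiMeasurePreserving hemp.quasiMeasurePreserving
    have hF'i : Integrable F' (D.prod μ) := Integrable.of_bound hF'm.aestronglyMeasurable K
      (Filter.Eventually.of_forall fun p => hK _)
    set φ : Z → ℝ := fun z => ∫ S, F' (z, S) ∂μ with hφ
    have hφm : AEMeasurable φ D := hF'i.integral_prod_left.aestronglyMeasurable.aemeasurable
    have hint : ∫ S, F S ∂(Measure.pi fun _ => D) = ∫ z, φ z ∂D := by
      rw [← hemp.integral_comp', integral_prod _ hF'i]
    have hsec : ∀ z S i z', |F' (z, Function.update S i z') - F' (z, S)| ≤ c :=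
      fun z S i z' => by
        simp only [hF', hecons, Fin.cons_update]
        exact hc _ _ _
    have hfst : ∀ z z' S, |F' (z', S) - F' (z, S)| ≤ c := fun z z' S => by
      simp only [hF', hecons]
      have := hc (Fin.cons z S : Fin (m + 1) → Z) 0 z'
      rwa [Fin.update_cons_zero] at this
    have hgood := hF'i.prod_right_ae
    obtain ⟨z₀, hz₀⟩ := hgood.exists
    have hφc : ∀ᵐ z ∂D, |φ z - φ z₀| ≤ c := by
      filter_upwards [hgood] with z hz
      have h1 : ‖∫ S, (F' (z, S) - F' (z₀, S)) ∂μ‖ ≤ c * μ.real Set.univ :=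
        norm_integral_le_of_norm_le_const (Filter.Eventually.of_forall fun S => hfst z₀ z S)
      rw [integral_sub hz hz₀] at h1
      simpa using h1
    have hexp := integrable_exp_of_abs_le hF'm (K := K) (fun p => hK _) t (∫ z, φ z ∂D)
    have hinner : ∀ᵐ z ∂D, ∫ S, Real.exp (t * (F' (z, S) - ∫ z, φ z ∂D)) ∂μ
        ≤ Real.exp (m * c ^ 2 * t ^ 2 / 2) * Real.exp (t * (φ z - ∫ z, φ z ∂D)) := by
      filter_upwards [hgood] with z hz
      have h1 := ih hz.aestronglyMeasurable.aemeasurable (fun S => hK _) (hsec z)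
      calc ∫ S, Real.exp (t * (F' (z, S) - ∫ z, φ z ∂D)) ∂μ
          = ∫ S, Real.exp (t * (F' (z, S) - φ z)) * Real.exp (t * (φ z - ∫ z, φ z ∂D)) ∂μ := by
            refine integral_congr_ae (Filter.Eventually.of_forall fun S => ?_)
            simp only [← Real.exp_add]
            congr 1
            ring
        _ = (∫ S, Real.exp (t * (F' (z, S) - φ z)) ∂μ) * Real.exp (t * (φ z - ∫ z, φ z ∂D)) :=
            integral_mul_const _ _
        _ ≤ _ := by gcongr
    have hφK : ∀ z, |φ z| ≤ K := fun z => by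
      have h1 : ‖∫ S, F' (z, S) ∂μ‖ ≤ K * μ.real Set.univ :=
        norm_integral_le_of_norm_le_const (Filter.Eventually.of_forall fun S => hK _)
      simpa using h1
    calc ∫ S, Real.exp (t * (F S - ∫ S, F S ∂(Measure.pi fun _ => D))) ∂(Measure.pi fun _ => D)
        = ∫ p, Real.exp (t * (F' p - ∫ z, φ z ∂D)) ∂(D.prod μ) := by
          rw [hint, ← hemp.integral_comp']
      _ = ∫ z, ∫ S, Real.exp (t * (F' (z, S) - ∫ z, φ z ∂D)) ∂μ ∂D := integral_prod _ hexp
      _ ≤ ∫ z, Real.exp (m * c ^ 2 * t ^ 2 / 2) * Real.exp (t * (φ z - ∫ z, φ z ∂D)) ∂D :=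
          integral_mono_ae hexp.integral_prod_left
            ((integrable_exp_of_abs_le hφm hφK t _).const_mul _) hinner
      _ ≤ Real.exp (m * c ^ 2 * t ^ 2 / 2) * Real.exp (c ^ 2 * t ^ 2 / 2) := by
          rw [integral_const_mul]
          gcongr
          exact integral_exp_sub_integral_le hφm hφc t
      _ = _ := by
          rw [← Real.exp_add]
          congr 1
          push_cast
          ring

/-- The bounded difference inequality, without optimal constant. -/
theorem ofReal_one_sub_le_of_boundedDifferences {m : ℕ} (hm : 1 ≤ m) {F : (Fin m → Z) → ℝ}
    (hF : AEMeasurable F (Measure.pi fun _ => D)) {K c : ℝ} (hK : ∀ S, |F S| ≤ K) (hc0 : 0 < c)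
    (hc : ∀ S i z, |F (Function.update S i z) - F S| ≤ c) {δ : ℝ} (hδ : 0 < δ) (hδ1 : δ < 1) :
    ENNReal.ofReal (1 - δ) ≤ (Measure.pi fun _ : Fin m => D)
      {S | F S ≤ ∫ S, F S ∂(Measure.pi fun _ => D) + √(2 * (m * c ^ 2) * Real.log (1 / δ))} := by
  set μ : Measure (Fin m → Z) := Measure.pi fun _ => D with hμ
  have hm0 : (0 : ℝ) < m := by exact_mod_cast hm
  obtain ⟨V, hV⟩ : ∃ V : ℝ≥0, (V : ℝ) = m * c ^ 2 := ⟨⟨m * c ^ 2, by positivity⟩, rfl⟩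
  have hsub : ProbabilityTheory.HasSubgaussianMGF (fun S => F S - ∫ S, F S ∂μ) V μ :=
    ⟨fun t => integrable_exp_of_abs_le hF hK t _,
      fun t => by rw [hV]; exact integral_exp_le_of_boundedDifferences hF hK hc t⟩
  have hlog : 0 < Real.log (1 / δ) := Real.log_pos (by rw [lt_div_iff₀ hδ]; linarith)
  set ε := √(2 * (m * c ^ 2) * Real.log (1 / δ)) with hε
  have htail := hsub.measure_ge_le (ε := ε) (Real.sqrt_nonneg _)
  have hexp : Real.exp (-ε ^ 2 / (2 * V)) = δ := by
    rw [hε, Real.sq_sqrt (by positivity), hV, neg_div,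
      mul_div_cancel_left₀ _ (by positivity), one_div, Real.log_inv, neg_neg, Real.exp_log hδ]
  rw [hexp] at htail
  have hcompl : {S | F S ≤ ∫ S, F S ∂μ + ε}ᶜ ⊆ {S | ε ≤ F S - ∫ S, F S ∂μ} := fun S hS => by
    simp only [Set.mem_compl_iff, Set.mem_ofPred_eq, not_le] at hS ⊢
    linarith
  have hnull : NullMeasurableSet {S | F S ≤ ∫ S, F S ∂μ + ε} μ :=
    nullMeasurableSet_le hF aemeasurable_const
  have h1 : μ.real {S | F S ≤ ∫ S, F S ∂μ + ε}ᶜ ≤ δ := (measureReal_mono hcompl).trans htail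
  rw [probReal_compl_eq_one_sub₀ hnull] at h1
  rw [ENNReal.ofReal_le_iff_le_toReal (measure_ne_top _ _)]
  change 1 - δ ≤ μ.real _
  linarith

end BoundedDifferences

/-! ### Representativeness -/

section Representativeness

variable {X : Type u} [MeasurableSpace X] {Y : Type v} [MeasurableSpace Y] {H : Set (X → ℝ)}
  {ℓ : ℝ → Y → ℝ} {B : ℝ} {D : Measure (X × Y)}

lemma MeasurableLossClass.aemeasurable_rep (hM : MeasurableLossClass ℓ D H) (m : ℕ) :
    AEMeasurable (fun S : Fin m → X × Y => rep ℓ D H S) (Measure.pi fun _ => D) := by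
  refine (hM.sup m 1 fun _ => -(m : ℝ)⁻¹).congr (Filter.Eventually.of_forall fun S => ?_)
  refine iSup_congr fun h => ?_
  rw [empLoss, ← Finset.mul_sum]
  ring

variable [IsProbabilityMeasure D]

lemma nonneg_of_abs_loss_le (D : Measure (X × Y)) [IsProbabilityMeasure D]
    (hB : ∀ t y, |ℓ t y| ≤ B) : 0 ≤ B :=
  (abs_nonneg _).trans (hB 0 (nonempty_of_isProbabilityMeasure D).some.2)

lemma abs_distLoss_sub_empLoss_le (hB : ∀ t y, |ℓ t y| ≤ B) {m : ℕ} (hm : 1 ≤ m)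
    (S : Fin m → X × Y) (h : X → ℝ) : |distLoss ℓ D h - empLoss ℓ S h| ≤ 2 * B := by
  have hm0 : (0 : ℝ) < m := by exact_mod_cast hm
  have h1 : |distLoss ℓ D h| ≤ B := by
    have h1 : ‖∫ z : X × Y, ℓ (h z.1) z.2 ∂D‖ ≤ B * D.real Set.univ :=
      norm_integral_le_of_norm_le_const (Filter.Eventually.of_forall fun z => hB _ _)
    simpa [distLoss] using h1
  have h2 : |empLoss ℓ S h| ≤ B := by
    rw [empLoss, abs_div, Nat.abs_cast, div_le_iff₀ hm0]
    refine (Finset.abs_sum_le_sum_abs _ _).trans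
      ((Finset.sum_le_sum fun i _ => hB _ _).trans (le_of_eq ?_))
    simp [mul_comm]
  linarith [abs_sub (distLoss ℓ D h) (empLoss ℓ S h)]

lemma abs_rep_le (hB : ∀ t y, |ℓ t y| ≤ B) {m : ℕ} (hm : 1 ≤ m) (S : Fin m → X × Y) :
    |rep ℓ D H S| ≤ 2 * B := by
  rcases isEmpty_or_nonempty H with hH | hH
  · have := nonneg_of_abs_loss_le D hB
    rw [rep, Real.iSup_of_isEmpty, abs_zero]
    linarith
  · exact abs_ciSup_le fun h : H => abs_distLoss_sub_empLoss_le hB hm S (h : X → ℝ)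

lemma MeasurableLossClass.integrable_rep (hM : MeasurableLossClass ℓ D H)
    (hB : ∀ t y, |ℓ t y| ≤ B) {m : ℕ} (hm : 1 ≤ m) :
    Integrable (fun S : Fin m → X × Y => rep ℓ D H S) (Measure.pi fun _ => D) :=
  Integrable.of_bound (hM.aemeasurable_rep m).aestronglyMeasurable _
    (Filter.Eventually.of_forall (abs_rep_le hB hm))

lemma ciSup_sub_ciSup_le {I : Type*} [Nonempty I] {φ ψ : I → ℝ} {c : ℝ}
    (hψ : BddAbove (Set.range ψ)) (h : ∀ i, φ i - ψ i ≤ c) : (⨆ i, φ i) - ⨆ i, ψ i ≤ c := by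
  rw [sub_le_iff_le_add]
  exact ciSup_le fun i => by linarith [h i, le_ciSup hψ i]

lemma abs_rep_update_sub_rep_le (hB : ∀ t y, |ℓ t y| ≤ B) {m : ℕ} (S : Fin m → X × Y)
    (i : Fin m) (z : X × Y) :
    |rep ℓ D H (Function.update S i z) - rep ℓ D H S| ≤ 2 * B / m := by
  have hm : 1 ≤ m := by have := i.2; omega
  have hB0 := nonneg_of_abs_loss_le D hB
  rcases isEmpty_or_nonempty H with hH | hH
  · rw [rep, rep, Real.iSup_of_isEmpty, Real.iSup_of_isEmpty, sub_zero, abs_zero]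
    positivity
  have hemp : ∀ h : X → ℝ, |empLoss ℓ (Function.update S i z) h - empLoss ℓ S h| ≤ 2 * B / m :=
    fun h => by
      rw [empLoss, empLoss, ← sub_div, ← Finset.sum_sub_distrib,
        Finset.sum_eq_single i (fun j _ hj => by simp [hj]) (by simp), Function.update_self,
        abs_div, Nat.abs_cast]
      gcongr
      linarith [abs_sub (ℓ (h z.1) z.2) (ℓ (h (S i).1) (S i).2), hB (h z.1) z.2,
        hB (h (S i).1) (S i).2]
  have hbdd : ∀ S : Fin m → X × Y, BddAbove (Set.range fun h : H =>
      distLoss ℓ D (h : X → ℝ) - empLoss ℓ S (h : X → ℝ)) := fun S =>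
    bddAbove_range_of_abs_le fun h => abs_distLoss_sub_empLoss_le hB hm S _
  refine abs_sub_le_iff.2 ⟨ciSup_sub_ciSup_le (hbdd _) fun h => ?_,
    ciSup_sub_ciSup_le (hbdd _) fun h => ?_⟩
  · linarith [(abs_le.1 (hemp h)).1]
  · linarith [(abs_le.1 (hemp h)).2]

theorem HasADL.integral_rep_le {n : ℕ → ℝ≥0} (hH : HasADL.{u, 0, w} H n) {L : ℝ≥0}
    (hL : ∀ y, LipschitzWith L (fun t => ℓ t y)) (hB : ∀ t y, |ℓ t y| ≤ B)
    (hM : MeasurableLossClass ℓ D H) {m : ℕ} (hm : 2 ≤ m) :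
    ∫ S : Fin m → X × Y, rep ℓ D H S ∂(Measure.pi fun _ => D) ≤
      140 * (((L : ℝ) + B) * √(n m : ℝ) / √(m : ℝ) * Real.log m) := by
  have hB0 := nonneg_of_abs_loss_le D hB
  have hm0 : (0 : ℝ) < m := by positivity
  have hlog : 0 ≤ Real.log m := Real.log_natCast_nonneg m
  rcases isEmpty_or_nonempty H with hE | hE
  · simp only [rep, Real.iSup_of_isEmpty, integral_zero]
    positivity
  -- The chaining needs a positive description length `r > n m`; the bound is continuous in `r`.
  have hlim : Filter.Tendsto (fun r : ℝ => 140 * (((L : ℝ) + B) * √r / √(m : ℝ) * Real.log m))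
      (nhdsWithin (n m : ℝ) (Set.Ioi (n m)))
      (nhds (140 * (((L : ℝ) + B) * √(n m : ℝ) / √(m : ℝ) * Real.log m))) :=
    (Continuous.tendsto (by fun_prop) _).mono_left nhdsWithin_le_nhds
  refine ge_of_tendsto hlim (Filter.eventually_of_mem self_mem_nhdsWithin fun r hr => ?_)
  have hr' : (n m : ℝ) < r := hr
  have hr0 : 0 < r := lt_of_le_of_lt (n m).2 hr'
  refine (integral_ciSup_sub_le (f := fun (h : H) (z : X × Y) => ℓ ((h : X → ℝ) z.1) z.2)
    (fun h => hM.loss h h.2) (fun _ _ => hB _ _) hM.sup (by omega)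
    (fun S a => hH.signMean_loss_le hL hB hm hr'.le hr0 S a)
    (hM.integrable_rep hB (by omega))).trans (le_of_eq ?_)
  rw [Real.sqrt_mul hr0.le]
  have hs : √(m : ℝ) * √(m : ℝ) = m := Real.mul_self_sqrt hm0.le
  have hs0 : √(m : ℝ) ≠ 0 := (Real.sqrt_pos.2 hm0).ne'
  nth_rewrite 3 [← hs]
  field_simp
  ring

theorem HasADL.ofReal_one_sub_le_measure_rep_le {n : ℕ → ℝ≥0} (hH : HasADL.{u, 0, w} H n)
    {L : ℝ≥0} (hL : ∀ y, LipschitzWith L (fun t => ℓ t y)) (hB : ∀ t y, |ℓ t y| ≤ B)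
    (hM : MeasurableLossClass ℓ D H) {m : ℕ} (hm : 1 ≤ m) {δ : ℝ} (hδ : 0 < δ) (hδ1 : δ < 1) :
    ENNReal.ofReal (1 - δ) ≤ (Measure.pi fun _ : Fin m => D)
      {S : Fin m → X × Y | rep ℓ D H S ≤
        140 * (((L : ℝ) + B) * √(n m : ℝ) / √(m : ℝ) * Real.log m +
          B * √(2 * Real.log (2 / δ) / (m : ℝ)))} := by
  have hB0 := nonneg_of_abs_loss_le D hB
  have hm0 : (0 : ℝ) < m := by exact_mod_cast hm
  have hlog : 0 ≤ Real.log m := Real.log_natCast_nonneg m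
  have hmean0 : 0 ≤ ((L : ℝ) + B) * √(n m : ℝ) / √(m : ℝ) * Real.log m := by positivity
  -- In the degenerate cases `m = 1` and `B = 0` the bound `rep ≤ 2 B` is enough.
  have htriv : ∀ R : ℝ, 2 * B ≤ R → ENNReal.ofReal (1 - δ) ≤
      (Measure.pi fun _ : Fin m => D) {S : Fin m → X × Y | rep ℓ D H S ≤ R} := fun R hR => by
    have huniv : {S : Fin m → X × Y | rep ℓ D H S ≤ R} = Set.univ :=
      Set.eq_univ_of_forall fun S => ((le_abs_self _).trans (abs_rep_le hB hm S)).trans hR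
    rw [huniv, measure_univ]
    simp [hδ.le]
  rcases hB0.eq_or_lt with hB1 | hB1
  · refine htriv _ ?_
    rw [← hB1] at hmean0 ⊢
    linarith
  rcases hm.eq_or_lt with rfl | hm2
  · refine htriv _ ?_
    have h1 : Real.log 2 ≤ Real.log (2 / δ) :=
      Real.log_le_log (by norm_num) (by rw [le_div_iff₀ hδ]; linarith)
    have h2 : 1 ≤ √(2 * Real.log (2 / δ) / ((1 : ℕ) : ℝ)) := by
      rw [Real.one_le_sqrt]
      have := Real.log_two_gt_d9
      norm_num
      linarith
    have h3 := mul_le_mul_of_nonneg_left h2 hB0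
    linarith
  refine (ofReal_one_sub_le_of_boundedDifferences hm (hM.aemeasurable_rep m)
    (abs_rep_le hB hm) (c := 2 * B / m) (by positivity) (abs_rep_update_sub_rep_le hB) hδ
    hδ1).trans (measure_mono fun S hS => ?_)
  have hS' : rep ℓ D H S ≤ ∫ S, rep ℓ D H S ∂(Measure.pi fun _ : Fin m => D) +
    √(2 * (m * (2 * B / m) ^ 2) * Real.log (1 / δ)) := hS
  have hmean := hH.integral_rep_le hL hB hM hm2
  have hdev : √(2 * (m * (2 * B / m) ^ 2) * Real.log (1 / δ))
      ≤ 2 * B * √(2 * Real.log (2 / δ) / (m : ℝ)) := by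
    have h1 : Real.log (1 / δ) ≤ Real.log (2 / δ) :=
      Real.log_le_log (by positivity) (by gcongr; norm_num)
    rw [show 2 * (m * (2 * B / m) ^ 2) * Real.log (1 / δ)
      = (2 * B) ^ 2 * (2 * Real.log (1 / δ) / m) by field_simp,
      Real.sqrt_mul (by positivity), Real.sqrt_sq (by positivity)]
    gcongr
  have hnn : 0 ≤ B * √(2 * Real.log (2 / δ) / (m : ℝ)) := by positivity
  change rep ℓ D H S ≤ _
  linarith

end Representativeness

end ADL

theorem theorem1 :
    ∃ C : ℝ, 0 < C ∧
      -- the covering number bound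
      (∀ (X : Type u) (H : Set (X → ℝ)) (n : ℕ → ℝ≥0), ADL.HasADL.{u, 0, w} H n →
        ∀ (m : ℕ) (ε : ℝ), 0 < ε →
          ADL.coveringNumber H m ε ≠ ⊤ ∧
          Real.log ((ADL.coveringNumber H m ε).toNat : ℝ) ≤ C * ((n m : ℝ) * (⌈1 / ε ^ 2⌉₊ : ℝ))) ∧
      -- the generalization bounds
      (∀ (X : Type u) [MeasurableSpace X] (Y : Type v) [MeasurableSpace Y]
        (H : Set (X → ℝ)) (n : ℕ → ℝ≥0), ADL.HasADL.{u, 0, w} H n →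
        ∀ (ℓ : ℝ → Y → ℝ) (L : ℝ≥0) (B : ℝ),
          (∀ y, LipschitzWith L (fun t => ℓ t y)) → (∀ t y, |ℓ t y| ≤ B) →
        ∀ (D : Measure (X × Y)) [IsProbabilityMeasure D], ADL.MeasurableLossClass ℓ D H →
          -- in expectation
          (∀ m : ℕ, 2 ≤ m →
            Integrable (fun S : Fin m → X × Y => ADL.rep ℓ D H S)
              (Measure.pi fun _ : Fin m => D) ∧
            ∫ S : Fin m → X × Y, ADL.rep ℓ D H S ∂(Measure.pi fun _ : Fin m => D) ≤
              C * (((L : ℝ) + B) * √(n m : ℝ) / √(m : ℝ) * Real.log m)) ∧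
          -- with high probability
          (∀ m : ℕ, 1 ≤ m → ∀ δ : ℝ, 0 < δ → δ < 1 →
            ENNReal.ofReal (1 - δ) ≤ (Measure.pi fun _ : Fin m => D)
              {S : Fin m → X × Y | ADL.rep ℓ D H S ≤
                C * (((L : ℝ) + B) * √(n m : ℝ) / √(m : ℝ) * Real.log m +
                  B * √(2 * Real.log (2 / δ) / (m : ℝ)))})) := by
  refine ⟨140, by norm_num, fun X H n hH m ε hε => ?_, fun X _ Y _ H n hH ℓ L B hL hB D _ hM =>
    ⟨fun m hm => ⟨hM.integrable_rep hB (by omega), hH.integral_rep_le hL hB hM hm⟩,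
      fun m hm δ hδ hδ1 => hH.ofReal_one_sub_le_measure_rep_le hL hB hM hm hδ hδ1⟩⟩
  obtain ⟨htop, hle⟩ := hH.log_coveringNumber_le m hε
  have : 0 ≤ (n m : ℝ) * (⌈1 / ε ^ 2⌉₊ : ℝ) := by positivity
  exact ⟨htop, by linarith⟩
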